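/- **Conventions.** A *commutative unital locally $C^*$-algebra* is a commutative unital $*$-algebra $A$ over $\mathbb C$ with a complete Hausdorff topology generated by a family of $C^*$-seminorms, i.e. seminorms $s$ with $s(ab)\le s(a)s(b)$, $s(a^*)=s(a)$ and $s(a^*a)=s(a)^2$ (no normalization $s(1)=1$ is required; $A=0$ is allowed). $S(A)$ is the set of all continuous $C^*$-seminorms on $A$. Morphisms of these algebras are the continuous unital $*$-homomorphisms. A *primitive ideal* of $A$ is the kernel of an irreducible representation, i.e. of a continuous unital $*$-homomorphism $\pi:A\to B(H)$, $H\neq 0$ a Hilbert space, without closed invariant subspaces other than $0$ and $H$. $\operatorname{Prim}A$ is the set of primitive ideals; the closure of $F\subset\operatorname{Prim}A$ in the hull-kernel topology is $\{P : \bigcap_{I\in F} I\subset P\}$. For $s\in S(A)$ the set $\operatorname{Prim}A_s$, where $A_s=A/\ker s$, is identified with $\{P\in\operatorname{Prim}A : \ker s\subset P\}$. In the *direct limit topology* a set $C\subset\operatorname{Prim}A$ is closed if and only if $C\cap\operatorname{Prim}A_s$ is closed in $\operatorname{Prim}A_s$, with respect to the hull-kernel topology, for every $s\in S(A)$. From now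 on $\operatorname{Prim}A$ carries the direct limit topology. A *distinguished family of compact sets* in a topological space $X$ is a nonempty family $F$ of compact subsets of $X$ which contains all singletons, all compact subsets of its members and all unions of two members, and is such that $\bigcup F=X$ and a set $C\subset X$ is closed if and only if $C\cap K$ is closed in $K$ for every $K\in F$. A space is *compactly generated* if it admits a distinguished family of compact sets, and *functionally Hausdorff* if any two distinct points are separated by a continuous real-valued function. For a family $F$ as above, $C(X)$ denotes the $*$-algebra of continuous functions $X\to\mathbb C$ with the topology of uniform convergence on the members of $F$. Morphisms $(X,F)\to(Y,G)$ are the continuous maps $f:X\to Y$ with $f(K)\in G$ for every $K\in F$. **Theorem.** Let $A$ be a commutative unital locally $C^*$-algebra. Then: 1. $\operatorname{Prim}A$ is compactly generated and functionally Hausdorff, and $(\operatorname{Prim}A_s)_{s\in S(A)}$ is a distinguished family of compact sets in it. 2. $A$ is isomorphic, as a topological $*$-algebra, to $C(\operatorname{Prim}A)$ with the topology of uniform convergence on the sets $\operatorname{Prim}A_s$, $s\in S(A)$. Moreover, $(X,F)\mapsto C(X)$ (on morphisms: composition $g\mapsto g\circ f$) and $A\mapsto(\operatorname{Prim}A,(\operatorname{Prim}A_s)_{s\in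 S(A)})$ (on morphisms: $P\mapsto\varphi^{-1}(P)$) are well-defined contravariant functors between the category of commutative unital locally $C^*$-algebras and the category of compactly generated, functionally Hausdorff spaces equipped with a distinguished family of compact sets, and they form a duality: they are the two functors of an equivalence between the opposite of the first category and the second. -/

import Mathlib

open CategoryTheory Topology

universe u

noncomputable section

namespace LocCStar

/-! ### Spaces with a distinguished family of compact sets -/

/-- Distinguished families of compact sets. The requirement that the family be nonempty (equivalently
`∅ ∈ F`) is automatic unless `X` is empty. -/
structure IsDistinguishedFamily {X : Type u} [TopologicalSpace X] (F : Set (Set X)) : Prop where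
  nonempty : F.Nonempty
  isCompact : ∀ K ∈ F, IsCompact K
  singleton_mem : ∀ x : X, {x} ∈ F
  mem_of_subset : ∀ K ∈ F, ∀ L : Set X, L ⊆ K → IsCompact L → L ∈ F
  union_mem : ∀ K ∈ F, ∀ L ∈ F, K ∪ L ∈ F
  sUnion_eq : ⋃₀ F = Set.univ
  isClosed_iff : ∀ C : Set X,
    IsClosed C ↔ ∀ K ∈ F, IsClosed ((Subtype.val : K → X) ⁻¹' C)

/-- A compactly generated space: a space which admits a distinguished family of compact sets. -/
def IsCompactlyGeneratedSpace (X : Type u) [TopologicalSpace X] : Prop :=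
  ∃ F : Set (Set X), IsDistinguishedFamily F

/-- Functionally Hausdorff: points can be separated by continuous real-valued functions. -/
def IsFunctionallyHausdorff (X : Type u) [TopologicalSpace X] : Prop :=
  ∀ x y : X, x ≠ y → ∃ f : C(X, ℝ), f x ≠ f y

/-- A compactly generated, functionally Hausdorff space equipped with a distinguished family of
compact sets. -/
structure DistSpace : Type (u + 1) where
  carrier : Type u
  [top : TopologicalSpace carrier]
  family : Set (Set carrier)
  isDistinguished : IsDistinguishedFamily family
  isFunctionallyHausdorff : IsFunctionallyHausdorff carrier

attribute [instance] DistSpace.top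

/-- Continuous maps such that the image of each set of the distinguished family of the source is a
member of the distinguished family of the target. -/
@[ext]
structure DistSpace.Hom (X Y : DistSpace.{u}) : Type u where
  toMap : C(X.carrier, Y.carrier)
  image_mem : ∀ K ∈ X.family, toMap '' K ∈ Y.family

instance : Category.{u} DistSpace.{u} where
  Hom X Y := DistSpace.Hom X Y
  id X := ⟨ContinuousMap.id _, fun K hK => by simpa using hK⟩
  comp f g := ⟨g.toMap.comp f.toMap, fun K hK => by
    have h := g.image_mem _ (f.image_mem K hK)
    rwa [Set.image_image] at h⟩

/-! ### Commutative unital locally C⋆-algebras -/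

/-- C⋆-seminorms (the zero seminorm is one of them). -/
structure IsCStarSeminorm {A : Type u} [CommRing A] [StarRing A] [Algebra ℂ A]
    (s : Seminorm ℂ A) : Prop where
  mul_le : ∀ a b : A, s (a * b) ≤ s a * s b
  star_eq : ∀ a : A, s (star a) = s a
  star_mul_self : ∀ a : A, s (star a * a) = s a ^ 2

/-- A commutative unital locally C⋆-algebra: a commutative unital `*`-algebra over `ℂ` whose topology
is Hausdorff, complete and generated by a family of C⋆-seminorms. The uniform structure is the one
that the topology determines on the additive group `A`. -/
class CommLocallyCStarAlgebra (A : Type u) [CommRing A] [StarRing A] [Algebra ℂ A]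
    [UniformSpace A] : Prop where
  starModule : StarModule ℂ A
  isUniformAddGroup : IsUniformAddGroup A
  t2Space : T2Space A
  completeSpace : CompleteSpace A
  generated : ∃ S : Set (Seminorm ℂ A), (∀ s ∈ S, IsCStarSeminorm s) ∧
    WithSeminorms (fun s : S => (s : Seminorm ℂ A))

/-- Bundled commutative unital locally C⋆-algebras. -/
structure CommLocCStarAlg : Type (u + 1) where
  carrier : Type u
  [commRing : CommRing carrier]
  [starRing : StarRing carrier]
  [algebra : Algebra ℂ carrier]
  [uniformSpace : UniformSpace carrier]
  [isLocallyCStar : CommLocallyCStarAlgebra carrier]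

attribute [instance] CommLocCStarAlg.commRing CommLocCStarAlg.starRing CommLocCStarAlg.algebra
  CommLocCStarAlg.uniformSpace CommLocCStarAlg.isLocallyCStar

/-- Morphisms are the continuous unital `*`-homomorphisms. -/
@[ext]
structure CommLocCStarAlg.Hom (A B : CommLocCStarAlg.{u}) : Type u where
  toHom : A.carrier →⋆ₐ[ℂ] B.carrier
  continuous_toHom : Continuous toHom

instance : Category.{u} CommLocCStarAlg.{u} where
  Hom A B := CommLocCStarAlg.Hom A B
  id A := ⟨StarAlgHom.id ℂ A.carrier, continuous_id⟩
  comp f g := ⟨g.toHom.comp f.toHom, g.continuous_toHom.comp f.continuous_toHom⟩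

/-! ### The primitive spectrum -/

section Prim

variable (A : Type u) [CommRing A] [StarRing A] [Algebra ℂ A] [UniformSpace A]

variable {A} in
/-- A primitive ideal is the kernel of an irreducible representation, that is, of a continuous unital
`*`-homomorphism `π : A → B(H)`, `H` a nonzero Hilbert space, without nontrivial closed invariant
subspaces. -/
def IsPrimitiveIdeal (P : Ideal A) : Prop :=
  ∃ (H : Type u) (_ : NormedAddCommGroup H) (_ : InnerProductSpace ℂ H) (_ : CompleteSpace H)
    (π : A →⋆ₐ[ℂ] (H →L[ℂ] H)),
    Nontrivial H ∧ Continuous π ∧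
    (∀ W : Submodule ℂ H, IsClosed (W : Set H) → (∀ a : A, ∀ w ∈ W, π a w ∈ W) →
      W = ⊥ ∨ W = ⊤) ∧
    ∀ a : A, a ∈ P ↔ π a = 0

/-- The set of primitive ideals. -/
def Prim : Type u := {P : Ideal A // IsPrimitiveIdeal P}

variable {A}

/-- The hull-kernel closure of a set of primitive ideals. -/
def hkClosure (F : Set (Prim A)) : Set (Prim A) :=
  {P | ∀ a : A, (∀ I ∈ F, a ∈ I.1) → a ∈ P.1}

/-- The kernel of an irreducible representation is a prime ideal. -/
theorem IsPrimitiveIdeal.mem_or_mem {P : Ideal A} (hP : IsPrimitiveIdeal P) {a b : A}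
    (hab : a * b ∈ P) : a ∈ P ∨ b ∈ P := by
  obtain ⟨H, _, _, _, π, -, -, hirr, hker⟩ := hP
  rw [hker, map_mul] at hab
  rw [hker, hker]
  have hcl : IsClosed ((π a).ker : Set H) := (π a).isClosed_ker
  rcases hirr (π a).ker hcl (fun c w hw => by
    have hc : π a * π c = π c * π a := by rw [← map_mul, mul_comm, map_mul]
    have h1 : π a (π c w) = π c (π a w) := DFunLike.congr_fun hc w
    have h2 : π a w = 0 := hw
    change π a (π c w) = 0
    rw [h1, h2, map_zero]) with h | h
  · right
    ext w
    have : π b w ∈ (π a).ker := DFunLike.congr_fun hab w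
    rw [h] at this
    simpa using this
  · left
    ext w
    have : w ∈ (π a).ker := by rw [h]; trivial
    simpa using this

variable (A) in
/-- The hull-kernel topology: `F` is closed if it equals (contains) its hull-kernel closure. -/
@[reducible]
def hullKernelTopology : TopologicalSpace (Prim A) :=
  TopologicalSpace.ofClosed {F | hkClosure F ⊆ F}
    (fun P hP => by
      obtain ⟨H, _, _, _, π, hH, -, -, hker⟩ := P.2
      have h1 : (1 : A) ∈ P.1 := hP 1 (fun I hI => hI.elim)
      rw [hker, map_one] at h1
      exact (one_ne_zero h1).elim)
    (fun 𝓕 h𝓕 P hP F hF => h𝓕 hF fun a ha => hP a fun I hI => ha I (hI F hF))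
    (fun F hF G hG P hP => by
      by_contra hn
      have h1 : P ∉ hkClosure F := fun h => hn (Or.inl (hF h))
      have h2 : P ∉ hkClosure G := fun h => hn (Or.inr (hG h))
      simp only [hkClosure, Set.mem_ofPred_eq, not_forall] at h1 h2
      obtain ⟨a, ha, haP⟩ := h1
      obtain ⟨b, hb, hbP⟩ := h2
      rcases P.2.mem_or_mem (hP (a * b) (by
        rintro I (hI | hI)
        · exact I.1.mul_mem_right b (ha I hI)
        · exact I.1.mul_mem_left a (hb I hI))) with h | h
      · exact haP h
      · exact hbP h)

variable (A) in
/-- The set `S(A)` of all continuous C⋆-seminorms. -/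
def contCStarSeminorms : Set (Seminorm ℂ A) :=
  {s | IsCStarSeminorm s ∧ Continuous s}

/-- The set `h(ker s)` of primitive ideals containing the kernel of `s`. It is identified with the
primitive spectrum of the C⋆-algebra `A_s = A / ker s` through pull-back along `A → A_s`. -/
def hullKer (s : Seminorm ℂ A) : Set (Prim A) :=
  {P | ∀ a : A, s a = 0 → a ∈ P.1}

/-- The direct limit topology: a set is closed if and only if its intersection with every
`h(ker s)`, `s ∈ S(A)`, is closed for the hull-kernel topology of `h(ker s)`. -/
instance directLimitTopology : TopologicalSpace (Prim A) :=
  ⨆ s : contCStarSeminorms A,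
    TopologicalSpace.coinduced (Subtype.val : hullKer (s : Seminorm ℂ A) → Prim A)
      (TopologicalSpace.induced (Subtype.val : hullKer (s : Seminorm ℂ A) → Prim A)
        (hullKernelTopology A))

variable (A) in
/-- The family `(Prim A_s)`, `s ∈ S(A)`, of subsets of `Prim A`. -/
def primFamily : Set (Set (Prim A)) :=
  {K | ∃ s ∈ contCStarSeminorms A, K = hullKer s}

end Prim

/-! ### The algebra of continuous functions with the topology of a family of sets -/

/-- `C(X)`, to be equipped with the topology of uniform convergence on the members of `F`. -/
def FunAlg (X : Type u) [TopologicalSpace X] (_F : Set (Set X)) : Type u := C(X, ℂ)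

section FunAlg

variable {X : Type u} [TopologicalSpace X] (F : Set (Set X))

instance : CommRing (FunAlg X F) := inferInstanceAs (CommRing C(X, ℂ))

instance : StarRing (FunAlg X F) := inferInstanceAs (StarRing C(X, ℂ))

instance : Algebra ℂ (FunAlg X F) := inferInstanceAs (Algebra ℂ C(X, ℂ))

/-- Uniform convergence on the members of `F`. -/
instance : UniformSpace (FunAlg X F) :=
  UniformSpace.comap (fun f : C(X, ℂ) => UniformOnFun.ofFun F (f : X → ℂ)) inferInstance

variable {F} in
/-- Composition with a continuous map `f : X → Y`, as a `*`-homomorphism `C(Y) → C(X)`. -/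
def FunAlg.comp {Y : Type u} [TopologicalSpace Y] {G : Set (Set Y)} (f : C(X, Y)) :
    FunAlg Y G →⋆ₐ[ℂ] FunAlg X F :=
  ContinuousMap.compStarAlgHom' ℂ ℂ f

end FunAlg

/-! ### The two functors -/

/-- The assignment `X ↦ C(X)` is well defined on objects and morphisms. -/
structure FunWellDefined : Prop where
  isLocallyCStar : ∀ X : DistSpace.{u}, CommLocallyCStarAlgebra (FunAlg X.carrier X.family)
  continuous_comp : ∀ {X Y : DistSpace.{u}} (f : X ⟶ Y),
    Continuous (FunAlg.comp f.toMap : FunAlg Y.carrier Y.family →⋆ₐ[ℂ] FunAlg X.carrier X.family)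

/-- The contravariant functor `X ↦ C(X)`. -/
def funFunctor (h : FunWellDefined.{u}) : DistSpace.{u}ᵒᵖ ⥤ CommLocCStarAlg.{u} where
  obj X :=
    { carrier := FunAlg X.unop.carrier X.unop.family
      isLocallyCStar := h.isLocallyCStar X.unop }
  map f := ⟨FunAlg.comp f.unop.toMap, h.continuous_comp f.unop⟩

/-- The map `Prim B → Prim A`, `P ↦ φ⁻¹(P)`: the kernel of an irreducible representation of `B` is sent
to the kernel of its pull-back along `φ`. -/
def primComap {A B : CommLocCStarAlg.{u}} (φ : A ⟶ B)
    (h : ∀ P : Prim B.carrier, IsPrimitiveIdeal (P.1.comap φ.toHom)) :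
    Prim B.carrier → Prim A.carrier :=
  fun P => ⟨P.1.comap φ.toHom, h P⟩

/-- The assignment `A ↦ Prim A` is well defined on objects and morphisms. -/
structure PrimWellDefined : Prop where
  isDistinguished : ∀ A : CommLocCStarAlg.{u}, IsDistinguishedFamily (primFamily A.carrier)
  isFunctionallyHausdorff : ∀ A : CommLocCStarAlg.{u}, IsFunctionallyHausdorff (Prim A.carrier)
  isPrimitiveIdeal_comap : ∀ {A B : CommLocCStarAlg.{u}} (φ : A ⟶ B) (P : Prim B.carrier),
    IsPrimitiveIdeal (P.1.comap φ.toHom)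
  continuous_comap : ∀ {A B : CommLocCStarAlg.{u}} (φ : A ⟶ B),
    Continuous (primComap φ (isPrimitiveIdeal_comap φ))
  image_mem : ∀ {A B : CommLocCStarAlg.{u}} (φ : A ⟶ B), ∀ K ∈ primFamily B.carrier,
    primComap φ (isPrimitiveIdeal_comap φ) '' K ∈ primFamily A.carrier

/-- The contravariant functor `A ↦ Prim A`. -/
def primFunctor (h : PrimWellDefined.{u}) : CommLocCStarAlg.{u}ᵒᵖ ⥤ DistSpace.{u} where
  obj A :=
    { carrier := Prim A.unop.carrier
      family := primFamily A.unop.carrier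
      isDistinguished := h.isDistinguished A.unop
      isFunctionallyHausdorff := h.isFunctionallyHausdorff A.unop }
  map φ := ⟨⟨primComap φ.unop (h.isPrimitiveIdeal_comap φ.unop), h.continuous_comap φ.unop⟩,
    h.image_mem φ.unop⟩

end LocCStar

end

noncomputable section

namespace LocCStar

/-! ### C⋆-seminorms are attained at characters -/

/-! An irreducible representation of a commutative algebra is scalar, so `Prim A` is the set of
continuous characters, and the theorem is Gelfand theory carried out one seminorm at a time.

A C⋆-seminorm `s` is the supremum of the `|χ|` over the characters with `|χ| ≤ s`
(`seminorm_le_of_forall_dominated`), and for continuous `s` these characters form a pointwise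
compact set (`isCompact_dominated`). By Stone-Weierstrass `A` is dense in the continuous functions
on each such set, and completeness of `A` glues the approximations: every function continuous on all
these sets is a Gelfand transform (`exists_forall_apply_eq`).

This gives surjectivity of the Gelfand transform and also elements that vanish on a compact set of
characters but not at a given outside point (`exists_apply_eq_one_of_isCompact`). That separation
drives the rest. It identifies `hullKer s` with the characters dominated by `s`, where the
hull-kernel and Gelfand topologies then agree; it shows that a compact part of some `hullKer s` is
itself a `hullKer t` (`mem_primFamily_iff`); and it shows that continuous characters of `C(X)` are
evaluations at points. The Gelfand transform and point evaluation are then the two natural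
isomorphisms of the duality. -/

/-- All elements are normal, so the norm is the spectral radius; it is attained at a spectral value,
and spectral values are values of characters. -/
theorem exists_character_norm_eq {C : Type u} [CommCStarAlgebra C] (c : C) (hc : c ≠ 0) :
    ∃ χ : C →⋆ₐ[ℂ] ℂ, (∀ x, ‖χ x‖ ≤ ‖x‖) ∧ ‖χ c‖ = ‖c‖ := by
  have : Nontrivial C := ⟨⟨c, 0, hc⟩⟩
  obtain ⟨z, hz, hzn⟩ := spectrum.exists_nnnorm_eq_spectralRadius c
  have hn : IsStarNormal c := ⟨mul_comm _ _⟩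
  rw [hn.spectralRadius_eq_nnnorm] at hzn
  obtain ⟨f, hf⟩ := WeakDual.CharacterSpace.mem_spectrum_iff_exists.1 hz
  refine ⟨⟨WeakDual.CharacterSpace.toAlgHom f, fun x => map_star f x⟩, fun x => ?_, ?_⟩
  · exact spectrum.norm_le_norm_of_mem (WeakDual.CharacterSpace.mem_spectrum_iff_exists.2 ⟨f, rfl⟩)
  · change ‖f c‖ = ‖c‖
    rw [hf]
    exact congrArg NNReal.toReal (ENNReal.coe_injective hzn)

/-! ### Characters of C⋆-seminormed algebras, via the completion -/

section Completion

open UniformSpace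

variable {B : Type u} [SeminormedCommRing B] [NormedAlgebra ℂ B] [StarRing B] [StarModule ℂ B]

omit [NormedAlgebra ℂ B] [StarModule ℂ B] in
theorem uniformContinuous_star_of_norm_star (h : ∀ b : B, ‖star b‖ = ‖b‖) :
    UniformContinuous (star : B → B) :=
  (AddMonoidHomClass.isometry_of_norm (starAddEquiv : B ≃+ B) h).uniformContinuous

omit [NormedAlgebra ℂ B] [StarModule ℂ B] in
theorem completion_map_star_coe (h : ∀ b : B, ‖star b‖ = ‖b‖) (b : B) :
    Completion.map star (b : Completion B) = ((star b : B) : Completion B) :=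
  Completion.map_coe (uniformContinuous_star_of_norm_star h) b

omit [NormedAlgebra ℂ B] [StarModule ℂ B] in
theorem continuous_completion_map_star : Continuous (Completion.map (star : B → B)) :=
  Completion.continuous_map

omit [NormedAlgebra ℂ B] [StarModule ℂ B] in
/-- The involution of the completion of a ring with an isometric involution. -/
@[reducible]
def completionStarRing (h : ∀ b : B, ‖star b‖ = ‖b‖) : StarRing (Completion B) where
  star := Completion.map star
  star_involutive := fun x => by
    induction x using Completion.induction_on with
    | hp =>
      exact isClosed_eq (continuous_completion_map_star.comp continuous_completion_map_star)
        continuous_id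
    | ih b => rw [completion_map_star_coe h, completion_map_star_coe h, star_star]
  star_mul := fun x y => by
    change Completion.map star (x * y) = Completion.map star y * Completion.map star x
    have hc := continuous_completion_map_star (B := B)
    induction x, y using Completion.induction_on₂ with
    | hp => exact isClosed_eq (by fun_prop) (by fun_prop)
    | ih a b =>
      rw [← Completion.coe_mul, completion_map_star_coe h, completion_map_star_coe h,
        completion_map_star_coe h, ← Completion.coe_mul, star_mul]
  star_add := fun x y => by
    change Completion.map star (x + y) = Completion.map star x + Completion.map star y
    have hc := continuous_completion_map_star (B := B)
    induction x, y using Completion.induction_on₂ with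
    | hp => exact isClosed_eq (by fun_prop) (by fun_prop)
    | ih a b =>
      rw [← Completion.coe_add, completion_map_star_coe h, completion_map_star_coe h,
        completion_map_star_coe h, ← Completion.coe_add, star_add]

omit [NormedAlgebra ℂ B] [StarModule ℂ B] in
theorem norm_mul_self_le_norm_completion_map_star_mul (h1 : ∀ b : B, ‖star b‖ = ‖b‖)
    (h2 : ∀ b : B, ‖star b * b‖ = ‖b‖ ^ 2) (x : Completion B) :
    ‖x‖ * ‖x‖ ≤ ‖Completion.map star x * x‖ := by
  have hc := continuous_completion_map_star (B := B)
  induction x using Completion.induction_on with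
  | hp => exact isClosed_le (by fun_prop) (by fun_prop)
  | ih b =>
    rw [completion_map_star_coe h1, ← Completion.coe_mul, Completion.norm_coe,
      Completion.norm_coe, h2, sq]

theorem completion_map_star_smul (h1 : ∀ b : B, ‖star b‖ = ‖b‖) (r : ℂ) (x : Completion B) :
    Completion.map star (r • x) = star r • Completion.map star x := by
  have hc := continuous_completion_map_star (B := B)
  induction x using Completion.induction_on with
  | hp => exact isClosed_eq (hc.comp (continuous_const_smul r)) ((continuous_const_smul _).comp hc)
  | ih b =>
    rw [completion_map_star_coe h1, ← Completion.coe_smul, ← Completion.coe_smul,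
      completion_map_star_coe h1, star_smul]

/-- The completion of a commutative C⋆-seminormed algebra is a C⋆-algebra. -/
@[reducible]
def completionCommCStarAlgebra (h1 : ∀ b : B, ‖star b‖ = ‖b‖)
    (h2 : ∀ b : B, ‖star b * b‖ = ‖b‖ ^ 2) : CommCStarAlgebra (Completion B) :=
  letI : StarRing (Completion B) := completionStarRing h1
  { toCStarRing := ⟨norm_mul_self_le_norm_completion_map_star_mul h1 h2⟩
    toStarModule := ⟨completion_map_star_smul h1⟩ }

/-- The completion also divides out the null elements, and `B` maps to it preserving the norm, so a
character of the completion can be restricted to `B`. -/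
theorem exists_character_of_norm_ne_zero (h1 : ∀ b : B, ‖star b‖ = ‖b‖)
    (h2 : ∀ b : B, ‖star b * b‖ = ‖b‖ ^ 2) (a : B) (ha : ‖a‖ ≠ 0) :
    ∃ χ : B →⋆ₐ[ℂ] ℂ, (∀ b, ‖χ b‖ ≤ ‖b‖) ∧ ‖χ a‖ = ‖a‖ := by
  let _ := completionCommCStarAlgebra h1 h2
  obtain ⟨χ, h3, h4⟩ := exists_character_norm_eq (a : Completion B) (fun h => ha (by
    rw [← Completion.norm_coe, h, norm_zero]))
  refine ⟨{ toFun := fun b => χ b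
            map_one' := by rw [Completion.coe_one, map_one]
            map_mul' := fun x y => by rw [Completion.coe_mul, map_mul]
            map_zero' := by rw [Completion.coe_zero, map_zero]
            map_add' := fun x y => by rw [Completion.coe_add, map_add]
            commutes' := fun r => ?_
            map_star' := fun b => ?_ }, fun b => ?_, ?_⟩
  · rw [Algebra.algebraMap_eq_smul_one, Completion.coe_smul, map_smul, Completion.coe_one,
      map_one, Algebra.algebraMap_eq_smul_one]
  · rw [← map_star, ← completion_map_star_coe h1]
    rfl
  · exact (h3 b).trans_eq (Completion.norm_coe b)
  · exact h4.trans (Completion.norm_coe a)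

end Completion

theorem IsCStarSeminorm.exists_character {A : Type u} [CommRing A] [StarRing A] [Algebra ℂ A]
    [StarModule ℂ A] {s : Seminorm ℂ A} (hs : IsCStarSeminorm s) (a : A) (ha : s a ≠ 0) :
    ∃ χ : A →⋆ₐ[ℂ] ℂ, (∀ b, ‖χ b‖ ≤ s b) ∧ ‖χ a‖ = s a := by
  let _ : SeminormedCommRing A :=
    { RingSeminorm.toSeminormedRing (⟨s.toAddGroupSeminorm, hs.mul_le⟩ : RingSeminorm A),
      (inferInstance : CommRing A) with }
  have hnorm (b : A) : ‖b‖ = s b := rfl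
  let _ : NormedAlgebra ℂ A :=
    { (inferInstance : Algebra ℂ A) with
      norm_smul_le := fun r b => (map_smul_eq_mul s r b).le }
  exact exists_character_of_norm_ne_zero hs.star_eq hs.star_mul_self a ha

/-! ### Suprema of characters -/

section SupSeminorm

variable {A : Type u} [CommRing A] [StarRing A] [Algebra ℂ A] {ι : Type*}

/-- The supremum of the absolute values of a pointwise bounded family of characters. -/
def supSeminorm (χ : ι → A →⋆ₐ[ℂ] ℂ) (hb : ∀ a, BddAbove (Set.range fun i => ‖χ i a‖)) :
    Seminorm ℂ A :=
  Seminorm.of (fun a => ⨆ i, ‖χ i a‖)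
    -- The index type may be empty. The supremum is then `0`, which gives the zero seminorm.
    (fun a b => Real.iSup_le (fun i => by
      rw [map_add]
      exact (norm_add_le _ _).trans (add_le_add (le_ciSup (hb a) i) (le_ciSup (hb b) i)))
      (add_nonneg (Real.iSup_nonneg fun _ => norm_nonneg _)
        (Real.iSup_nonneg fun _ => norm_nonneg _)))
    (fun r a => by
      simp only [map_smul, norm_smul]
      rw [Real.mul_iSup_of_nonneg (norm_nonneg r)])

variable {χ : ι → A →⋆ₐ[ℂ] ℂ} (hb : ∀ a, BddAbove (Set.range fun i => ‖χ i a‖))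

theorem norm_le_supSeminorm (i : ι) (a : A) : ‖χ i a‖ ≤ supSeminorm χ hb a :=
  le_ciSup (hb a) i

theorem supSeminorm_le {a : A} {r : ℝ} (hr : 0 ≤ r) (h : ∀ i, ‖χ i a‖ ≤ r) :
    supSeminorm χ hb a ≤ r :=
  Real.iSup_le h hr

theorem isCStarSeminorm_supSeminorm : IsCStarSeminorm (supSeminorm χ hb) where
  mul_le a b := supSeminorm_le hb (mul_nonneg (apply_nonneg _ _) (apply_nonneg _ _)) fun i => by
    rw [map_mul, norm_mul]
    exact mul_le_mul (norm_le_supSeminorm hb i a) (norm_le_supSeminorm hb i b) (norm_nonneg _)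
      (apply_nonneg _ _)
  star_eq a := by
    change (⨆ i, ‖χ i (star a)‖) = ⨆ i, ‖χ i a‖
    simp only [map_star, norm_star]
  star_mul_self a := by
    have key (i : ι) : ‖χ i (star a * a)‖ = ‖χ i a‖ ^ 2 := by
      rw [map_mul, map_star, norm_mul, norm_star, sq]
    refine le_antisymm (supSeminorm_le hb (sq_nonneg _) fun i => ?_) ?_
    · rw [key]
      exact pow_le_pow_left₀ (norm_nonneg _) (norm_le_supSeminorm hb i a) 2
    -- Under a square root the claim becomes an upper bound for a supremum, to be checked on each
    -- character.
    · rw [← Real.le_sqrt (apply_nonneg _ _) (apply_nonneg _ _)]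
      refine supSeminorm_le hb (Real.sqrt_nonneg _) fun i => Real.le_sqrt_of_sq_le ?_
      rw [← key]
      exact norm_le_supSeminorm hb i _

end SupSeminorm

theorem IsCStarSeminorm.sup {A : Type u} [CommRing A] [StarRing A] [Algebra ℂ A]
    {s t : Seminorm ℂ A} (hs : IsCStarSeminorm s) (ht : IsCStarSeminorm t) :
    IsCStarSeminorm (s ⊔ t) where
  mul_le a b := by
    simp only [Seminorm.sup_apply]
    refine max_le ((hs.mul_le a b).trans ?_) ((ht.mul_le a b).trans ?_)
    · exact mul_le_mul (le_max_left _ _) (le_max_left _ _) (apply_nonneg _ _)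
        ((apply_nonneg s a).trans (le_max_left _ _))
    · exact mul_le_mul (le_max_right _ _) (le_max_right _ _) (apply_nonneg _ _)
        ((apply_nonneg s a).trans (le_max_left _ _))
  star_eq a := by simp only [Seminorm.sup_apply, hs.star_eq, ht.star_eq]
  star_mul_self a := by
    simp only [Seminorm.sup_apply, hs.star_mul_self, ht.star_mul_self]
    rcases le_total (s a) (t a) with h | h
    · rw [max_eq_right h, max_eq_right (pow_le_pow_left₀ (apply_nonneg _ _) h 2)]
    · rw [max_eq_left h, max_eq_left (pow_le_pow_left₀ (apply_nonneg _ _) h 2)]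

/-! ### Continuous C⋆-seminorms -/

section ContCStarSeminorms

variable {A : Type u} [CommRing A] [StarRing A] [Algebra ℂ A] [UniformSpace A]

omit [UniformSpace A] in
theorem isCStarSeminorm_zero : IsCStarSeminorm (0 : Seminorm ℂ A) where
  mul_le a b := by simp
  star_eq a := by simp
  star_mul_self a := by simp

theorem zero_mem_contCStarSeminorms : (0 : Seminorm ℂ A) ∈ contCStarSeminorms A :=
  ⟨isCStarSeminorm_zero, continuous_const⟩

theorem sup_mem_contCStarSeminorms {s t : Seminorm ℂ A} (hs : s ∈ contCStarSeminorms A)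
    (ht : t ∈ contCStarSeminorms A) : s ⊔ t ∈ contCStarSeminorms A :=
  ⟨hs.1.sup ht.1, hs.2.max ht.2⟩

/-- C⋆-seminorms are stable under finite maxima, so single seminorms already give a basis at `0`.
The empty maximum is the zero seminorm. -/
theorem exists_contCStarSeminorm_ball_subset [hA : CommLocallyCStarAlgebra A] {U : Set A}
    (hU : U ∈ 𝓝 (0 : A)) :
    ∃ s ∈ contCStarSeminorms A, ∃ ε > 0, ∀ a, s a < ε → a ∈ U := by
  obtain ⟨S, hS, hW⟩ := hA.generated
  have := hW.topologicalAddGroup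
  obtain ⟨⟨T, ε⟩, hε, hT⟩ := hW.hasBasis_zero_ball.mem_iff.1 hU
  refine ⟨T.sup fun s : S => (s : Seminorm ℂ A), ?_, ε, hε, fun a ha => hT ?_⟩
  · exact Finset.sup_induction zero_mem_contCStarSeminorms
      (fun s hs t ht => sup_mem_contCStarSeminorms hs ht)
      (fun s _ => ⟨hS s s.2, hW.continuous_seminorm s⟩)
  · rwa [Seminorm.mem_ball_zero]

theorem mem_contCStarSeminorms_of_le [CommLocallyCStarAlgebra A] {s t : Seminorm ℂ A}
    (hs : IsCStarSeminorm s) (ht : t ∈ contCStarSeminorms A) (hst : s ≤ t) :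
    s ∈ contCStarSeminorms A := by
  have := CommLocallyCStarAlgebra.isUniformAddGroup (A := A)
  exact ⟨hs, Seminorm.continuous_of_le ht.2 hst⟩

instance : Nonempty (contCStarSeminorms A) := ⟨⟨0, zero_mem_contCStarSeminorms⟩⟩

instance : IsDirectedOrder (contCStarSeminorms A) where
  directed s t := ⟨⟨s ⊔ t, sup_mem_contCStarSeminorms s.2 t.2⟩,
    (le_sup_left : s.1 ≤ s.1 ⊔ t.1), (le_sup_right : t.1 ≤ s.1 ⊔ t.1)⟩

end ContCStarSeminorms

/-! ### Continuous characters -/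

section ContChar

variable (A : Type u) [CommRing A] [StarRing A] [Algebra ℂ A] [UniformSpace A]

/-- The continuous characters of `A`, with the topology of pointwise convergence. -/
def ContChar : Type u := {χ : A →⋆ₐ[ℂ] ℂ // Continuous χ}

instance : TopologicalSpace (ContChar A) :=
  TopologicalSpace.induced (fun χ a => χ.1 a) (inferInstance : TopologicalSpace (A → ℂ))

variable {A}

theorem ContChar.isInducing : IsInducing (fun (χ : ContChar A) (a : A) => χ.1 a) := ⟨rfl⟩

theorem ContChar.ext {χ ψ : ContChar A} (h : ∀ a, χ.1 a = ψ.1 a) : χ = ψ :=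
  Subtype.ext (StarAlgHom.ext h)

theorem ContChar.injective : Function.Injective (fun (χ : ContChar A) (a : A) => χ.1 a) :=
  fun _ _ h => ContChar.ext fun a => congrFun h a

instance : T2Space (ContChar A) :=
  T2Space.of_injective_continuous ContChar.injective ContChar.isInducing.continuous

theorem ContChar.continuous_apply (a : A) : Continuous fun χ : ContChar A => χ.1 a :=
  (_root_.continuous_apply a).comp ContChar.isInducing.continuous

theorem ContChar.continuous_iff {Z : Type*} [TopologicalSpace Z] {f : Z → ContChar A} :
    Continuous f ↔ ∀ a, Continuous fun z => (f z).1 a := by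
  rw [ContChar.isInducing.continuous_iff, continuous_pi_iff]
  rfl

/-- The characters dominated by `s`. -/
def dominated (s : Seminorm ℂ A) : Set (ContChar A) := {χ | ∀ a, ‖χ.1 a‖ ≤ s a}

theorem dominated_mono {s t : Seminorm ℂ A} (h : s ≤ t) : dominated s ⊆ dominated t :=
  fun _ hχ a => (hχ a).trans (h a)

/-- The absolute value of a character. -/
def ContChar.seminorm (χ : ContChar A) : Seminorm ℂ A :=
  supSeminorm (fun _ : Unit => χ.1) fun _ => (Set.finite_range _).bddAbove

theorem ContChar.seminorm_apply (χ : ContChar A) (a : A) : χ.seminorm a = ‖χ.1 a‖ :=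
  ciSup_unique

theorem ContChar.seminorm_mem (χ : ContChar A) : χ.seminorm ∈ contCStarSeminorms A := by
  refine ⟨isCStarSeminorm_supSeminorm _, ?_⟩
  have h : (χ.seminorm : A → ℝ) = fun a => ‖χ.1 a‖ := funext χ.seminorm_apply
  rw [h]
  exact χ.2.norm

theorem ContChar.mem_dominated_seminorm (χ : ContChar A) : χ ∈ dominated χ.seminorm :=
  fun a => (χ.seminorm_apply a).ge

/-- Tychonoff: in a product of closed discs the characters are cut out by closed algebraic
conditions. Continuity needs no condition of its own, since domination by `s` forces it. -/
theorem isCompact_dominated [CommLocallyCStarAlgebra A] {s : Seminorm ℂ A}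
    (hs : s ∈ contCStarSeminorms A) : IsCompact (dominated s) := by
  have := CommLocallyCStarAlgebra.isUniformAddGroup (A := A)
  rw [ContChar.isInducing.isCompact_iff]
  have himg : (fun (χ : ContChar A) (a : A) => χ.1 a) '' dominated s =
      (Set.univ.pi fun a => Metric.closedBall (0 : ℂ) (s a)) ∩
      ({f | f 1 = 1} ∩ {f | ∀ a b, f (a * b) = f a * f b} ∩ {f | ∀ a b, f (a + b) = f a + f b} ∩
        {f | ∀ (r : ℂ) a, f (r • a) = r • f a} ∩ {f | ∀ a, f (star a) = star (f a)}) := by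
    ext f
    constructor
    · rintro ⟨χ, hχ, rfl⟩
      refine ⟨fun a _ => mem_closedBall_zero_iff.2 (hχ a), ⟨⟨⟨?_, ?_⟩, ?_⟩, ?_⟩, ?_⟩
      · exact map_one χ.1
      · exact map_mul χ.1
      · exact map_add χ.1
      · exact map_smul χ.1
      · exact map_star χ.1
    · rintro ⟨hb, ⟨⟨⟨h1, hmul⟩, hadd⟩, hsmul⟩, hstar⟩
      have hb' (a : A) : ‖f a‖ ≤ s a := mem_closedBall_zero_iff.1 (hb a trivial)
      let χ : A →⋆ₐ[ℂ] ℂ :=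
        { toFun := f
          map_one' := h1
          map_mul' := hmul
          map_zero' := by simpa using hsmul 0 0
          map_add' := hadd
          commutes' := fun r => by
            rw [Algebra.algebraMap_eq_smul_one, hsmul, h1, Algebra.algebraMap_eq_smul_one]
          map_star' := hstar }
      have hχ : Continuous χ := by
        refine continuous_of_continuousAt_zero χ ?_
        rw [ContinuousAt, map_zero]
        refine squeeze_zero_norm hb' ?_
        simpa using hs.2.tendsto 0
      exact ⟨⟨χ, hχ⟩, hb', rfl⟩
  rw [himg]
  refine (isCompact_univ_pi fun a => isCompact_closedBall _ _).inter_right ?_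
  refine (((IsClosed.inter ?_ ?_).inter ?_).inter ?_).inter ?_
  · exact isClosed_eq (by fun_prop) (by fun_prop)
  · simp only [Set.ofPred_forall]
    exact isClosed_iInter fun a => isClosed_iInter fun b => isClosed_eq (by fun_prop) (by fun_prop)
  · simp only [Set.ofPred_forall]
    exact isClosed_iInter fun a => isClosed_iInter fun b => isClosed_eq (by fun_prop) (by fun_prop)
  · simp only [Set.ofPred_forall]
    exact isClosed_iInter fun a => isClosed_iInter fun b => isClosed_eq (by fun_prop) (by fun_prop)
  · simp only [Set.ofPred_forall]
    exact isClosed_iInter fun a => isClosed_eq (by fun_prop) (by fun_prop)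

/-- A character attaining `s a` is dominated by `s`, hence continuous. The bound `0 ≤ r` covers `s a
= 0`, where there may be no dominated character at all. -/
theorem seminorm_le_of_forall_dominated [CommLocallyCStarAlgebra A] {s : Seminorm ℂ A}
    (hs : s ∈ contCStarSeminorms A) {a : A} {r : ℝ} (hr : 0 ≤ r)
    (h : ∀ χ ∈ dominated s, ‖χ.1 a‖ ≤ r) : s a ≤ r := by
  have := CommLocallyCStarAlgebra.isUniformAddGroup (A := A)
  have := CommLocallyCStarAlgebra.starModule (A := A)
  by_cases ha : s a = 0
  · rwa [ha]
  obtain ⟨χ, h1, h2⟩ := hs.1.exists_character a ha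
  have hχ : Continuous χ := by
    refine continuous_of_continuousAt_zero χ ?_
    rw [ContinuousAt, map_zero]
    refine squeeze_zero_norm h1 ?_
    simpa using hs.2.tendsto 0
  rw [← h2]
  exact h ⟨χ, hχ⟩ h1

/-- Elements of `A` are dense in the continuous functions on the characters dominated by `s`. -/
theorem exists_forall_dominated_norm_sub_lt [CommLocallyCStarAlgebra A] {s : Seminorm ℂ A}
    (hs : s ∈ contCStarSeminorms A) {f : ContChar A → ℂ} (hf : ContinuousOn f (dominated s))
    {ε : ℝ} (hε : 0 < ε) : ∃ a : A, ∀ χ ∈ dominated s, ‖χ.1 a - f χ‖ < ε := by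
  have : CompactSpace (dominated s) := isCompact_iff_compactSpace.1 (isCompact_dominated hs)
  let Γ : A →⋆ₐ[ℂ] C(dominated s, ℂ) :=
    { toFun := fun a => ⟨fun χ => χ.1.1 a,
        (ContChar.continuous_apply a).comp continuous_subtype_val⟩
      map_one' := by ext χ; exact map_one χ.1.1
      map_mul' := fun a b => by ext χ; exact map_mul χ.1.1 a b
      map_zero' := by ext χ; exact map_zero χ.1.1
      map_add' := fun a b => by ext χ; exact map_add χ.1.1 a b
      commutes' := fun r => by ext χ; exact AlgHomClass.commutes χ.1.1 r
      map_star' := fun a => by ext χ; exact map_star χ.1.1 a }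
  -- Points are characters, so two of them not separated by elements of `A` are equal.
  have hsep : Γ.range.SeparatesPoints := by
    intro χ ψ hne
    by_contra hcon
    push Not at hcon
    exact hne (Subtype.ext (ContChar.ext fun a =>
      hcon (Γ a) ⟨Γ a, ⟨a, rfl⟩, rfl⟩))
  have htop := ContinuousMap.starSubalgebra_topologicalClosure_eq_top_of_separatesPoints _ hsep
  let g : C(dominated s, ℂ) := ⟨fun χ => f χ, hf.domRestrict⟩
  have hg : g ∈ closure (Γ.range : Set C(dominated s, ℂ)) := by
    rw [← StarSubalgebra.topologicalClosure_coe, htop]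
    trivial
  obtain ⟨_, ⟨a, rfl⟩, ha⟩ := Metric.mem_closure_iff.1 hg ε hε
  refine ⟨a, fun χ hχ => ?_⟩
  have := (ContinuousMap.dist_lt_iff hε).1 ha ⟨χ, hχ⟩
  rwa [dist_comm, dist_eq_norm] at this

/-- Every function on the characters which is continuous on the sets of dominated characters is the
Gelfand transform of an element. -/
theorem exists_forall_apply_eq [CommLocallyCStarAlgebra A] (f : ContChar A → ℂ)
    (hf : ∀ s ∈ contCStarSeminorms A, ContinuousOn f (dominated s)) :
    ∃ a : A, ∀ χ : ContChar A, χ.1 a = f χ := by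
  have := CommLocallyCStarAlgebra.isUniformAddGroup (A := A)
  have := CommLocallyCStarAlgebra.completeSpace (A := A)
  have hne : (Filter.atTop : Filter (contCStarSeminorms A × ℕ)).NeBot := by
    rw [← Filter.prod_atTop_atTop_eq]
    infer_instance
  -- The net is indexed by pairs `(s, n)`: its member is within `1 / (n + 1)` of `f` on `dominated
  -- s`.
  choose a ha using fun i : contCStarSeminorms A × ℕ =>
    exists_forall_dominated_norm_sub_lt i.1.2 (hf i.1 i.1.2) (Nat.one_div_pos_of_nat (n := i.2))
  have hle (i j : contCStarSeminorms A × ℕ) (hij : i ≤ j) (χ : ContChar A)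
      (hχ : χ ∈ dominated i.1.1) : ‖χ.1 (a j) - f χ‖ < 1 / ((i.2 : ℝ) + 1) :=
    (ha j χ (dominated_mono hij.1 hχ)).trans_le (Nat.one_div_le_one_div hij.2)
  have hcauchy : CauchySeq a := by
    refine ⟨hne.map a, ?_⟩
    rw [uniformity_eq_comap_nhds_zero, ← Filter.tendsto_iff_comap, Filter.prod_map_map_eq,
      Filter.tendsto_map'_iff, Filter.prod_atTop_atTop_eq]
    intro U hU
    obtain ⟨s, hs, ε, hε, hU⟩ := exists_contCStarSeminorm_ball_subset hU
    obtain ⟨n, hn⟩ := exists_nat_one_div_lt (half_pos hε)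
    refine Filter.mem_map.2 (Filter.mem_of_superset
      (Filter.mem_atTop ((⟨s, hs⟩, n), (⟨s, hs⟩, n))) ?_)
    rintro ⟨i, j⟩ ⟨hi, hj⟩
    -- As `s` is a supremum over `dominated s`, `s (a j - a i)` is at most two errors, each below `ε
    -- / 2`.
    refine hU _ (lt_of_le_of_lt (seminorm_le_of_forall_dominated hs (r := 1 / ((n : ℝ) + 1) +
      1 / ((n : ℝ) + 1)) (by positivity) fun χ hχ => ?_) (by linarith))
    have h1 := hle (⟨s, hs⟩, n) i hi χ hχ
    have h2 := hle (⟨s, hs⟩, n) j hj χ hχ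
    have h3 : χ.1 (a j - a i) = (χ.1 (a j) - f χ) - (χ.1 (a i) - f χ) := by
      rw [map_sub]; ring
    change ‖χ.1 (a j - a i)‖ ≤ _
    rw [h3]
    exact (norm_sub_le _ _).trans (add_le_add h2.le h1.le)
  obtain ⟨l, hl⟩ := CompleteSpace.complete hcauchy
  refine ⟨l, fun χ => tendsto_nhds_unique ((χ.2.tendsto l).comp hl) ?_⟩
  rw [Metric.tendsto_nhds]
  intro ε hε
  obtain ⟨n, hn⟩ := exists_nat_one_div_lt hε
  -- Each `χ` is dominated by its own absolute value, so from that index on the net approximates `f`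
  -- at `χ`.
  filter_upwards [Filter.mem_atTop ((⟨χ.seminorm, χ.seminorm_mem⟩, n) :
    contCStarSeminorms A × ℕ)] with j hj
  rw [dist_eq_norm]
  exact (hle _ j hj χ χ.mem_dominated_seminorm).trans hn

/-- The compact set is closed in the completely regular space `A → ℂ`. A separating function there
restricts to the characters and is a Gelfand transform. -/
theorem exists_apply_eq_one_of_isCompact [CommLocallyCStarAlgebra A] {C : Set (ContChar A)}
    (hC : IsCompact C) {χ : ContChar A} (hχ : χ ∉ C) :
    ∃ a : A, (∀ ψ ∈ C, ψ.1 a = 0) ∧ χ.1 a = 1 := by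
  have hcl := (ContChar.isInducing.isCompact_iff.1 hC).isClosed
  obtain ⟨f, hf, hf0, hf1⟩ := CompletelyRegularSpace.completely_regular _ _ hcl
    (fun h => hχ ((ContChar.injective.mem_set_image).1 h))
  obtain ⟨a, ha⟩ := exists_forall_apply_eq
    (fun ψ : ContChar A => 1 - (((f fun a => ψ.1 a) : ℝ) : ℂ)) fun s _ => by
      refine Continuous.continuousOn (continuous_const.sub (Complex.continuous_ofReal.comp
        (continuous_subtype_val.comp (hf.comp ContChar.isInducing.continuous))))
  refine ⟨a, fun ψ hψ => ?_, ?_⟩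
  · rw [ha, hf1 ⟨ψ, hψ, rfl⟩]
    simp
  · rw [ha, hf0]
    simp

end ContChar

/-! ### Irreducible representations are characters -/

section Irreducible

variable {A : Type u} [CommRing A] [StarRing A] [Algebra ℂ A]
  {H : Type u} [NormedAddCommGroup H] [InnerProductSpace ℂ H] [CompleteSpace H]

open ContinuousLinearMap in
/-- An irreducible representation of a commutative `*`-algebra consists of scalars. -/
theorem exists_eq_algebraMap_of_irreducible [Nontrivial H] (π : A →⋆ₐ[ℂ] (H →L[ℂ] H))
    (hirr : ∀ W : Submodule ℂ H, IsClosed (W : Set H) → (∀ a : A, ∀ w ∈ W, π a w ∈ W) →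
      W = ⊥ ∨ W = ⊤) (a : A) : ∃ c : ℂ, π a = algebraMap ℂ (H →L[ℂ] H) c := by
  have hnormal : IsStarNormal (π a) := ⟨by
    rw [← map_star, commute_iff_eq, ← map_mul, ← map_mul, mul_comm]⟩
  obtain ⟨c, hc⟩ := spectrum.nonempty (π a)
  refine ⟨c, CFC.eq_algebraMap_of_spectrum_subset_singleton (π a) c fun d hd => ?_⟩
  by_contra hne
  have hpos : 0 < dist c d := dist_pos.2 (fun h => hne h.symm)
  -- Two distinct spectral values would have bump functions of radius `dist c d / 2` with disjoint
  -- supports, hence nonzero commuting operators with product zero.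
  let f : ℂ → ℂ → ℂ := fun x z => ((max 0 (dist c d / 2 - dist z x) : ℝ) : ℂ)
  have hf (x : ℂ) : Continuous (f x) := by
    refine Complex.continuous_ofReal.comp ?_
    fun_prop
  have hfx (x : ℂ) : f x x ≠ 0 := by
    simp only [f, dist_self, sub_zero, ne_eq, Complex.ofReal_eq_zero]
    exact (lt_max_of_lt_right (half_pos hpos)).ne'
  have hmul : (fun z => f c z * f d z) = fun _ => 0 := by
    funext z
    have := dist_triangle_left c d z
    rcases le_total (dist c d / 2) (dist z c) with h | h
    · simp only [f, max_eq_left (sub_nonpos.2 h), Complex.ofReal_zero, zero_mul]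
    · have h' : dist c d / 2 ≤ dist z d := by linarith
      simp only [f, max_eq_left (sub_nonpos.2 h'), Complex.ofReal_zero, mul_zero]
  have hprod : cfc (f c) (π a) * cfc (f d) (π a) = 0 := by
    rw [← cfc_mul (f c) (f d) (π a) (hf c).continuousOn (hf d).continuousOn, hmul]
    exact cfc_const_zero ℂ (π a)
  have hcomm (b : A) (g : ℂ → ℂ) : cfc g (π a) * π b = π b * cfc g (π a) := by
    refine Commute.cfc ?_ ?_ g
    · rw [commute_iff_eq, ← map_mul, ← map_mul, mul_comm]
    · rw [commute_iff_eq, ← map_star, ← map_mul, ← map_mul, mul_comm]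
  have hnz (x : ℂ) (hx : x ∈ spectrum ℂ (π a)) : cfc (f x) (π a) ≠ 0 := by
    intro h0
    have hmem : f x x ∈ spectrum ℂ (cfc (f x) (π a)) := by
      rw [cfc_map_spectrum (f x) (π a) hnormal (hf x).continuousOn]
      exact ⟨x, hx, rfl⟩
    rw [h0, spectrum.zero_eq] at hmem
    exact hfx x hmem
  -- This kernel is invariant. If it is zero, the second operator vanishes; if it is everything, the
  -- first does. Spectral mapping excludes both.
  rcases hirr (cfc (f c) (π a)).ker (cfc (f c) (π a)).isClosed_ker (fun b w hw => by
    have hw' : cfc (f c) (π a) w = 0 := hw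
    change (cfc (f c) (π a) * π b) w = 0
    rw [hcomm]
    change π b (cfc (f c) (π a) w) = 0
    rw [hw', map_zero]) with h | h
  · refine hnz d hd (ContinuousLinearMap.ext fun w => ?_)
    have : cfc (f d) (π a) w ∈ (cfc (f c) (π a)).ker := DFunLike.congr_fun hprod w
    rw [h] at this
    exact this
  · refine hnz c hc (ContinuousLinearMap.ext fun w => ?_)
    have : w ∈ (cfc (f c) (π a)).ker := by rw [h]; trivial
    exact this

end Irreducible

/-! ### Primitive ideals as kernels of continuous characters -/

section Prim

variable {A : Type u} [CommRing A] [StarRing A] [Algebra ℂ A] [UniformSpace A]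

/-- Scalars embed isometrically in `B(H)`, so the scalar by which each element acts inherits both
the algebraic identities and the continuity of the representation. -/
theorem IsPrimitiveIdeal.exists_contChar {P : Ideal A} (hP : IsPrimitiveIdeal P) :
    ∃ χ : ContChar A, ∀ a, a ∈ P ↔ χ.1 a = 0 := by
  obtain ⟨H, _, _, _, π, hH, hπ, hirr, hker⟩ := hP
  choose c hc using exists_eq_algebraMap_of_irreducible π hirr
  have hinj := (algebraMap ℂ (H →L[ℂ] H)).injective
  let χ : A →⋆ₐ[ℂ] ℂ :=
    { toFun := c
      map_one' := hinj (by rw [← hc, map_one, map_one])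
      map_mul' := fun a b => hinj (by rw [map_mul, ← hc, ← hc, ← hc, map_mul])
      map_zero' := hinj (by rw [← hc, map_zero, map_zero])
      map_add' := fun a b => hinj (by rw [map_add, ← hc, ← hc, ← hc, map_add])
      commutes' := fun r => hinj (by rw [← hc, AlgHomClass.commutes]; rfl)
      map_star' := fun a => hinj (by rw [← hc, map_star, hc, algebraMap_star_comm]) }
  have hχ : Continuous c := by
    have h : IsInducing (algebraMap ℂ (H →L[ℂ] H)) :=
      (algebraMap_isometry ℂ (H →L[ℂ] H)).isUniformInducing.isInducing
    rw [h.continuous_iff]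
    exact hπ.congr hc
  refine ⟨⟨χ, hχ⟩, fun a => ?_⟩
  change _ ↔ c a = 0
  rw [hker, hc, map_eq_zero_iff _ hinj]

theorem ContChar.isPrimitiveIdeal (χ : ContChar A) : IsPrimitiveIdeal (RingHom.ker χ.1) := by
  -- A one-dimensional space on which `A` acts through the character; `PUnit.{u + 1}` keeps it in
  -- `Type u`.
  let H := EuclideanSpace ℂ PUnit.{u + 1}
  have hH : Module.finrank ℂ H = 1 := by simp [H]
  have hHn : Nontrivial H := Module.nontrivial_of_finrank_pos (R := ℂ) (by rw [hH]; exact one_pos)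
  refine ⟨H, inferInstance, inferInstance, inferInstance,
    (StarAlgHom.ofId ℂ (H →L[ℂ] H)).comp χ.1, hHn, ?_, fun W _ _ => ?_, fun a => ?_⟩
  · exact (algebraMap_isometry ℂ (H →L[ℂ] H)).continuous.comp χ.2
  · have : IsSimpleModule ℂ H := isSimpleModule_iff_finrank_eq_one.2 hH
    exact eq_bot_or_eq_top W
  · exact (map_eq_zero_iff _ (algebraMap ℂ (H →L[ℂ] H)).injective).symm

/-- The continuous character with a given primitive ideal as its kernel. -/
def Prim.toContChar (P : Prim A) : ContChar A := P.2.exists_contChar.choose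

theorem Prim.mem_iff (P : Prim A) (a : A) : a ∈ P.1 ↔ P.toContChar.1 a = 0 :=
  P.2.exists_contChar.choose_spec a

/-- The kernel of a continuous character. -/
def ContChar.toPrim (χ : ContChar A) : Prim A := ⟨RingHom.ker χ.1, χ.isPrimitiveIdeal⟩

/-- The element `a - χ(a)·1` lies in the kernel of `χ`, so `ψ` kills it and `ψ a = χ a`. -/
theorem ContChar.eq_of_forall_eq_zero {χ ψ : ContChar A} (h : ∀ a, χ.1 a = 0 → ψ.1 a = 0) :
    χ = ψ := ContChar.ext fun a => by
  have h1 := h (a - algebraMap ℂ A (χ.1 a)) (by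
    rw [map_sub, AlgHomClass.commutes, Algebra.algebraMap_self_apply, sub_self])
  rw [map_sub, AlgHomClass.commutes, Algebra.algebraMap_self_apply, sub_eq_zero] at h1
  exact h1.symm

/-- Primitive ideals correspond to continuous characters. -/
def primEquiv : Prim A ≃ ContChar A where
  toFun := Prim.toContChar
  invFun := ContChar.toPrim
  left_inv P := Subtype.ext (Ideal.ext fun a => (P.mem_iff a).symm)
  right_inv χ := (ContChar.eq_of_forall_eq_zero fun a ha => (χ.toPrim.mem_iff a).1 ha).symm

@[simp] theorem ContChar.toContChar_toPrim (χ : ContChar A) : χ.toPrim.toContChar = χ :=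
  primEquiv.apply_symm_apply χ

@[simp] theorem Prim.toPrim_toContChar (P : Prim A) : P.toContChar.toPrim = P :=
  primEquiv.symm_apply_apply P

theorem Prim.toContChar_injective : Function.Injective (Prim.toContChar (A := A)) :=
  primEquiv.injective

end Prim

/-! ### The direct limit topology -/

section Topology

variable {A : Type u} [CommRing A] [StarRing A] [Algebra ℂ A] [UniformSpace A]

theorem isClosed_hullKernelTopology_iff {C : Set (Prim A)} :
    IsClosed[hullKernelTopology A] C ↔ hkClosure C ⊆ C := by
  rw [← @isOpen_compl_iff _ _ (hullKernelTopology A)]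
  change hkClosure Cᶜᶜ ⊆ Cᶜᶜ ↔ _
  rw [compl_compl]

/-- The Gelfand topology is finer than the hull-kernel topology. -/
theorem continuous_hullKernel {Z : Type*} [TopologicalSpace Z] {f : Z → Prim A}
    (hf : ∀ a, Continuous fun z => (f z).toContChar.1 a) :
    @Continuous Z (Prim A) _ (hullKernelTopology A) f := by
  refine (@continuous_iff_isClosed Z (Prim A) _ (hullKernelTopology A) f).2 fun C hC => ?_
  have hC' : hkClosure C ⊆ C := isClosed_hullKernelTopology_iff.1 hC
  have h : f ⁻¹' C = ⋂ a : {a : A // ∀ I ∈ C, a ∈ I.1}, {z | (f z).toContChar.1 a = 0} := by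
    ext z
    simp only [Set.mem_preimage, Set.mem_iInter]
    exact ⟨fun hz a => ((f z).mem_iff a).1 (a.2 _ hz),
      fun hz => hC' fun a ha => ((f z).mem_iff a).2 (hz ⟨a, ha⟩)⟩
  rw [h]
  exact isClosed_iInter fun a => isClosed_eq (hf a) continuous_const

/-- A map into the set of primitive ideals containing the kernel of some `s ∈ S(A)` is continuous if it
is continuous for the Gelfand topology. -/
theorem continuous_of_forall_mem_hullKer {Z : Type*} [TopologicalSpace Z] {f : Z → Prim A}
    {s : Seminorm ℂ A} (hs : s ∈ contCStarSeminorms A) (hmem : ∀ z, f z ∈ hullKer s)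
    (hf : ∀ a, Continuous fun z => (f z).toContChar.1 a) : Continuous f := by
  -- The hull-kernel topology replaces the default subspace topology here; the inclusion is
  -- continuous for it by the definition of the direct limit.
  let _ : TopologicalSpace (hullKer s) :=
    TopologicalSpace.induced Subtype.val (hullKernelTopology A)
  have h1 : Continuous fun z => (⟨f z, hmem z⟩ : hullKer s) :=
    continuous_induced_rng.2 (continuous_hullKernel hf)
  have h2 : Continuous (Subtype.val : hullKer s → Prim A) := by
    rw [continuous_iff_coinduced_le]
    exact le_iSup (fun s : contCStarSeminorms A =>
      TopologicalSpace.coinduced (Subtype.val : hullKer (s : Seminorm ℂ A) → Prim A)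
        (TopologicalSpace.induced (Subtype.val : hullKer (s : Seminorm ℂ A) → Prim A)
          (hullKernelTopology A))) ⟨s, hs⟩
  exact h2.comp h1

variable [CommLocallyCStarAlgebra A]

theorem hkClosure_subset_of_isCompact {C : Set (Prim A)}
    (hC : IsCompact (Prim.toContChar '' C)) : hkClosure C ⊆ C := by
  intro P hP
  by_contra hn
  obtain ⟨a, ha, ha1⟩ := exists_apply_eq_one_of_isCompact hC (χ := P.toContChar)
    (fun h => hn (Prim.toContChar_injective.mem_set_image.1 h))
  have := (P.mem_iff a).1 (hP a fun I hI => (I.mem_iff a).2 (ha _ ⟨I, hI, rfl⟩))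
  exact one_ne_zero (ha1.symm.trans this)

/-- If `χ` is not dominated by `s`, some `a` vanishes on `dominated s` while `χ a = 1`. Then `s a =
0`, so the kernel of `χ` does not contain that of `s`. -/
theorem mem_hullKer_iff {s : Seminorm ℂ A} (hs : s ∈ contCStarSeminorms A) (P : Prim A) :
    P ∈ hullKer s ↔ P.toContChar ∈ dominated s := by
  constructor
  · intro hP
    by_contra hn
    obtain ⟨a, ha, ha1⟩ := exists_apply_eq_one_of_isCompact (isCompact_dominated hs) hn
    have hsa : s a = 0 := le_antisymm
      (seminorm_le_of_forall_dominated hs le_rfl fun χ hχ => by rw [ha χ hχ, norm_zero])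
      (apply_nonneg s a)
    exact one_ne_zero (ha1.symm.trans ((P.mem_iff a).1 (hP a hsa)))
  · intro hP a ha
    exact (P.mem_iff a).2 (norm_le_zero_iff.1 ((hP a).trans_eq ha))

theorem isClosed_of_isCompact_image {C : Set (Prim A)}
    (hC : ∀ s ∈ contCStarSeminorms A, IsCompact (Prim.toContChar '' (C ∩ hullKer s))) :
    IsClosed C := by
  refine isClosed_iSup_iff.2 fun s => isClosed_coinduced.2 ?_
  refine (@isClosed_induced_iff _ _ (hullKernelTopology A) _ _).2 ⟨C ∩ hullKer s, ?_, ?_⟩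
  · exact isClosed_hullKernelTopology_iff.2 (hkClosure_subset_of_isCompact (hC s s.2))
  · ext P
    exact and_iff_left P.2

/-- Preimages of closed sets meet each `dominated s` in a compact set, and compact sets of
characters are hull-kernel closed. -/
theorem continuous_prim_of_continuousOn {Y : Type*} [TopologicalSpace Y] {g : Prim A → Y}
    (hg : ∀ s ∈ contCStarSeminorms A,
      ContinuousOn (fun χ : ContChar A => g χ.toPrim) (dominated s)) : Continuous g := by
  refine continuous_iff_isClosed.2 fun C hC => isClosed_of_isCompact_image fun s hs => ?_
  have h : Prim.toContChar '' (g ⁻¹' C ∩ hullKer s) =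
      dominated s ∩ (fun χ : ContChar A => g χ.toPrim) ⁻¹' C := by
    ext χ
    constructor
    · rintro ⟨P, ⟨hP, hPs⟩, rfl⟩
      exact ⟨(mem_hullKer_iff hs P).1 hPs, by simpa using hP⟩
    · rintro ⟨hχ, hC⟩
      exact ⟨χ.toPrim, ⟨hC, (mem_hullKer_iff hs _).2 (by simpa using hχ)⟩, χ.toContChar_toPrim⟩
  rw [h]
  have hcpt := isCompact_dominated hs
  exact hcpt.of_isClosed_subset ((hg s hs).preimage_isClosed_of_isClosed hcpt.isClosed hC)
    Set.inter_subset_left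

theorem continuous_toContChar : Continuous (Prim.toContChar (A := A)) :=
  continuous_prim_of_continuousOn fun s _ => by
    simp only [ContChar.toContChar_toPrim]
    exact continuousOn_id

theorem continuous_toContChar_apply (a : A) : Continuous fun P : Prim A => P.toContChar.1 a :=
  (ContChar.continuous_apply a).comp continuous_toContChar

instance : T2Space (Prim A) :=
  T2Space.of_injective_continuous Prim.toContChar_injective continuous_toContChar

theorem continuousOn_toPrim {s : Seminorm ℂ A} (hs : s ∈ contCStarSeminorms A) :
    ContinuousOn (ContChar.toPrim (A := A)) (dominated s) := by
  rw [continuousOn_iff_continuous_domRestrict]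
  refine continuous_of_forall_mem_hullKer hs (fun χ => ?_) fun a => ?_
  · rw [mem_hullKer_iff hs]
    change χ.1.toPrim.toContChar ∈ _
    simp
  · change Continuous fun χ : dominated s => χ.1.toPrim.toContChar.1 a
    simp only [ContChar.toContChar_toPrim]
    exact (ContChar.continuous_apply a).comp continuous_subtype_val

theorem isCompact_of_isCompact_image {s : Seminorm ℂ A} (hs : s ∈ contCStarSeminorms A)
    {K : Set (Prim A)} (hK : K ⊆ hullKer s) (hc : IsCompact (Prim.toContChar '' K)) :
    IsCompact K := by
  have h := hc.image_of_continuousOn ((continuousOn_toPrim hs).mono (by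
    rintro _ ⟨P, hP, rfl⟩
    exact (mem_hullKer_iff hs P).1 (hK hP)))
  simpa only [Set.image_image, Prim.toPrim_toContChar, Set.image_id'] using h

theorem toContChar_image_hullKer {s : Seminorm ℂ A} (hs : s ∈ contCStarSeminorms A) :
    Prim.toContChar '' hullKer s = dominated s := by
  ext χ
  constructor
  · rintro ⟨P, hP, rfl⟩
    exact (mem_hullKer_iff hs P).1 hP
  · exact fun hχ => ⟨χ.toPrim, (mem_hullKer_iff hs _).2 (by simpa using hχ), by simp⟩

theorem isCompact_hullKer {s : Seminorm ℂ A} (hs : s ∈ contCStarSeminorms A) :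
    IsCompact (hullKer s) :=
  isCompact_of_isCompact_image hs subset_rfl (by
    rw [toContChar_image_hullKer hs]
    exact isCompact_dominated hs)

omit [CommLocallyCStarAlgebra A] in
theorem hullKer_mono {s t : Seminorm ℂ A} (h : s ≤ t) :
    (hullKer s : Set (Prim A)) ⊆ hullKer t :=
  fun _ hP a ha => hP a (le_antisymm ((h a).trans_eq ha) (apply_nonneg s a))

/-- The sets `Prim A_s` are the compact sets which are contained in one of them. -/
theorem mem_primFamily_iff {K : Set (Prim A)} :
    K ∈ primFamily A ↔ IsCompact K ∧ ∃ s ∈ contCStarSeminorms A, K ⊆ hullKer s := by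
  constructor
  · rintro ⟨s, hs, rfl⟩
    exact ⟨isCompact_hullKer hs, s, hs, subset_rfl⟩
  · rintro ⟨hK, s, hs, hKs⟩
    have hle (P : K) (a : A) : ‖P.1.toContChar.1 a‖ ≤ s a := (mem_hullKer_iff hs _).1 (hKs P.2) a
    -- The only possible candidate: the supremum of the characters in `K`. It is continuous because
    -- it lies below `s`.
    let t := supSeminorm (fun P : K => P.1.toContChar.1) fun a =>
      ⟨s a, by rintro _ ⟨P, rfl⟩; exact hle P a⟩
    have ht : t ∈ contCStarSeminorms A :=
      mem_contCStarSeminorms_of_le (isCStarSeminorm_supSeminorm _) hs fun a =>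
        supSeminorm_le _ (apply_nonneg s a) fun P => hle P a
    refine ⟨t, ht, subset_antisymm (fun P hP => ?_) fun P hP => ?_⟩
    · exact (mem_hullKer_iff ht P).2 fun a =>
        norm_le_supSeminorm (χ := fun P : K => P.1.toContChar.1) _ ⟨P, hP⟩ a
    -- `t` vanishes on every element of the intersection of the ideals in `K`, so `P` lies in the
    -- hull-kernel closure of `K`, which is `K`.
    · refine hkClosure_subset_of_isCompact (hK.image continuous_toContChar) fun a ha => hP a ?_
      refine le_antisymm (supSeminorm_le _ le_rfl fun Q => ?_) (apply_nonneg t a)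
      rw [(Q.1.mem_iff a).1 (ha Q.1 Q.2), norm_zero]

theorem mem_hullKer_seminorm (P : Prim A) : P ∈ hullKer P.toContChar.seminorm :=
  (mem_hullKer_iff P.toContChar.seminorm_mem P).2 P.toContChar.mem_dominated_seminorm

theorem isDistinguishedFamily_primFamily : IsDistinguishedFamily (primFamily A) where
  nonempty := ⟨_, 0, zero_mem_contCStarSeminorms, rfl⟩
  isCompact K hK := (mem_primFamily_iff.1 hK).1
  singleton_mem P := mem_primFamily_iff.2 ⟨isCompact_singleton, _, P.toContChar.seminorm_mem,
    Set.singleton_subset_iff.2 (mem_hullKer_seminorm P)⟩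
  mem_of_subset K hK L hLK hL := by
    obtain ⟨-, s, hs, hKs⟩ := mem_primFamily_iff.1 hK
    exact mem_primFamily_iff.2 ⟨hL, s, hs, hLK.trans hKs⟩
  union_mem K hK L hL := by
    obtain ⟨hK, s, hs, hKs⟩ := mem_primFamily_iff.1 hK
    obtain ⟨hL, t, ht, hLt⟩ := mem_primFamily_iff.1 hL
    exact mem_primFamily_iff.2 ⟨hK.union hL, s ⊔ t, sup_mem_contCStarSeminorms hs ht,
      Set.union_subset (hKs.trans (hullKer_mono le_sup_left))
        (hLt.trans (hullKer_mono le_sup_right))⟩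
  sUnion_eq := Set.eq_univ_of_forall fun P =>
    ⟨_, ⟨_, P.toContChar.seminorm_mem, rfl⟩, mem_hullKer_seminorm P⟩
  isClosed_iff C := by
    refine ⟨fun hC K _ => hC.preimage continuous_subtype_val, fun h =>
      isClosed_of_isCompact_image fun s hs => IsCompact.image ?_ continuous_toContChar⟩
    have hK := isCompact_hullKer hs
    have h1 := h _ ⟨s, hs, rfl⟩
    have : CompactSpace (hullKer s) := isCompact_iff_compactSpace.1 hK
    have h2 := h1.isCompact.image continuous_subtype_val
    rwa [Subtype.image_preimage_coe, Set.inter_comm] at h2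

theorem isFunctionallyHausdorff_prim : IsFunctionallyHausdorff (Prim A) := by
  intro P Q hPQ
  by_contra! hcon
  refine hPQ (Prim.toContChar_injective (ContChar.ext fun a => Complex.ext ?_ ?_))
  · exact hcon ⟨_, Complex.continuous_re.comp (continuous_toContChar_apply a)⟩
  · exact hcon ⟨_, Complex.continuous_im.comp (continuous_toContChar_apply a)⟩

end Topology

/-! ### The locally C⋆-algebra of continuous functions -/

section FunAlg

variable {X : Type u} [TopologicalSpace X] {F : Set (Set X)}

theorem IsDistinguishedFamily.directedOn (hF : IsDistinguishedFamily F) : DirectedOn (· ⊆ ·) F :=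
  fun K hK L hL => ⟨K ∪ L, hF.union_mem K hK L hL, Set.subset_union_left, Set.subset_union_right⟩

theorem IsDistinguishedFamily.isCoherentWith (hF : IsDistinguishedFamily F) :
    IsCoherentWith F where
  isOpen_of_forall_induced U hU := by
    rw [← isClosed_compl_iff, hF.isClosed_iff]
    intro K hK
    rw [Set.preimage_compl, isClosed_compl_iff]
    exact hU K hK

variable (F) in
/-- Evaluation at a point. -/
def FunAlg.eval (x : X) : FunAlg X F →⋆ₐ[ℂ] ℂ := ContinuousMap.evalStarAlgHom ℂ ℂ x

theorem FunAlg.ext {f g : FunAlg X F} (h : ∀ x, eval F x f = eval F x g) : f = g :=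
  ContinuousMap.ext h

theorem FunAlg.continuous_eval_apply (f : FunAlg X F) : Continuous fun x => eval F x f :=
  ContinuousMap.continuous f

variable (X F) in
/-- The inclusion of the continuous functions into all functions. -/
def FunAlg.toUniformOnFun : FunAlg X F →+ UniformOnFun X ℂ F where
  toFun f := UniformOnFun.ofFun F fun x => eval F x f
  map_zero' := rfl
  map_add' _ _ := rfl

theorem FunAlg.isUniformInducing_toUniformOnFun : IsUniformInducing (toUniformOnFun X F) := ⟨rfl⟩

theorem FunAlg.toUniformOnFun_injective : Function.Injective (toUniformOnFun X F) :=
  fun _ _ h => FunAlg.ext fun x => congrFun h x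

instance : IsUniformAddGroup (FunAlg X F) := IsUniformAddGroup.comap (FunAlg.toUniformOnFun X F)

theorem FunAlg.hasBasis_nhds_zero (hF : IsDistinguishedFamily F) :
    (𝓝 (0 : FunAlg X F)).HasBasis (fun p : Set X × ℝ => p.1 ∈ F ∧ 0 < p.2)
      fun p => {f | ∀ x ∈ p.1, ‖eval F x f‖ < p.2} := by
  rw [isUniformInducing_toUniformOnFun.isInducing.nhds_eq_comap, map_zero]
  have h := (UniformOnFun.hasBasis_nhds_zero_of_basis F hF.nonempty hF.directedOn
    (Metric.nhds_basis_ball (x := (0 : ℂ)))).comap (toUniformOnFun X F)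
  convert h using 2 with p
  ext f
  simp only [Set.mem_preimage, Set.mem_ofPred_eq, mem_ball_zero_iff]
  rfl

theorem FunAlg.bddAbove_norm_eval (hF : IsDistinguishedFamily F) {K : Set X} (hK : K ∈ F)
    (f : FunAlg X F) : BddAbove (Set.range fun x : K => ‖eval F x.1 f‖) := by
  obtain ⟨c, hc⟩ := (hF.isCompact K hK).exists_bound_of_continuousOn
    (continuous_eval_apply f).continuousOn
  exact ⟨c, by rintro _ ⟨x, rfl⟩; exact hc x x.2⟩

/-- The supremum of the absolute value on a member of the family. -/
def FunAlg.supOn (hF : IsDistinguishedFamily F) {K : Set X} (hK : K ∈ F) :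
    Seminorm ℂ (FunAlg X F) :=
  supSeminorm (fun x : K => eval F x.1) (bddAbove_norm_eval hF hK)

theorem FunAlg.norm_eval_le_supOn (hF : IsDistinguishedFamily F) {K : Set X} (hK : K ∈ F) {x : X}
    (hx : x ∈ K) (f : FunAlg X F) : ‖eval F x f‖ ≤ supOn hF hK f :=
  norm_le_supSeminorm (χ := fun x : K => eval F x.1) _ ⟨x, hx⟩ f

theorem FunAlg.supOn_le (hF : IsDistinguishedFamily F) {K : Set X} (hK : K ∈ F)
    {f : FunAlg X F} {r : ℝ} (hr : 0 ≤ r) (h : ∀ x ∈ K, ‖eval F x f‖ ≤ r) : supOn hF hK f ≤ r :=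
  supSeminorm_le _ hr fun x => h x x.2

theorem FunAlg.continuous_supOn (hF : IsDistinguishedFamily F) {K : Set X} (hK : K ∈ F) :
    Continuous (supOn hF hK) := by
  refine Seminorm.continuous_of_continuousAt_zero ?_
  rw [ContinuousAt, map_zero, Metric.tendsto_nhds]
  intro ε hε
  filter_upwards [(hasBasis_nhds_zero hF).mem_of_mem (i := (K, ε / 2)) ⟨hK, half_pos hε⟩] with f hf
  rw [dist_zero_right, Real.norm_of_nonneg (apply_nonneg _ _)]
  exact (supOn_le hF hK (half_pos hε).le fun x hx => (hf x hx).le).trans_lt (half_lt_self hε)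

theorem FunAlg.supOn_mem (hF : IsDistinguishedFamily F) {K : Set X} (hK : K ∈ F) :
    supOn hF hK ∈ contCStarSeminorms (FunAlg X F) :=
  ⟨isCStarSeminorm_supSeminorm _, continuous_supOn hF hK⟩

theorem IsDistinguishedFamily.commLocallyCStarAlgebra (hF : IsDistinguishedFamily F) :
    CommLocallyCStarAlgebra (FunAlg X F) where
  starModule := inferInstanceAs (StarModule ℂ C(X, ℂ))
  isUniformAddGroup := inferInstance
  t2Space := by
    have := UniformOnFun.t2Space_of_covering (β := ℂ) hF.sUnion_eq
    exact T2Space.of_injective_continuous FunAlg.toUniformOnFun_injective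
      FunAlg.isUniformInducing_toUniformOnFun.uniformContinuous.continuous
  completeSpace := by
    rw [completeSpace_iff_isComplete_range FunAlg.isUniformInducing_toUniformOnFun]
    have h : Set.range (FunAlg.toUniformOnFun X F) =
        {f | Continuous (UniformOnFun.toFun F f)} := by
      ext f
      constructor
      · rintro ⟨g, rfl⟩
        exact FunAlg.continuous_eval_apply g
      · exact fun hf => ⟨(⟨UniformOnFun.toFun F f, hf⟩ : C(X, ℂ)), rfl⟩
    rw [h]
    -- A limit is continuous on each member of `F`, hence everywhere, since `F` determines the
    -- closed sets.
    exact (UniformOnFun.isClosed_setOfPred_continuous hF.isCoherentWith).isComplete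
  generated := by
    refine ⟨contCStarSeminorms (FunAlg X F), fun s hs => hs.1, ?_⟩
    refine (SeminormFamily.withSeminorms_iff_nhds_eq_iInf _).2 (le_antisymm ?_ ?_)
    · refine le_iInf fun s => Filter.tendsto_iff_comap.1 ?_
      simpa using s.2.2.tendsto 0
    · refine (FunAlg.hasBasis_nhds_zero hF).ge_iff.2 fun p hp => ?_
      refine Filter.mem_iInf_of_mem ⟨_, FunAlg.supOn_mem hF hp.1⟩ ?_
      refine ⟨_, Metric.ball_mem_nhds (0 : ℝ) hp.2, fun f hf x hx => ?_⟩
      refine (FunAlg.norm_eval_le_supOn hF hp.1 hx f).trans_lt ?_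
      exact (le_abs_self _).trans_lt (mem_ball_zero_iff.1 hf)

/-! ### Points of `X` as characters and primitive ideals of `C(X)` -/

theorem FunAlg.continuous_eval (hF : IsDistinguishedFamily F) (x : X) : Continuous (eval F x) := by
  refine continuous_of_continuousAt_zero (eval F x) ?_
  rw [ContinuousAt, map_zero]
  have h := (continuous_supOn hF (hF.singleton_mem x)).tendsto 0
  rw [map_zero] at h
  exact squeeze_zero_norm (fun f => norm_eval_le_supOn hF (hF.singleton_mem x) rfl f) h

/-- Evaluation at a point as a continuous character. -/
def FunAlg.evalChar (hF : IsDistinguishedFamily F) (x : X) : ContChar (FunAlg X F) :=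
  ⟨eval F x, continuous_eval hF x⟩

theorem FunAlg.continuous_evalChar (hF : IsDistinguishedFamily F) : Continuous (evalChar hF) :=
  ContChar.continuous_iff.2 fun f => continuous_eval_apply f

theorem FunAlg.evalChar_mem_dominated (hF : IsDistinguishedFamily F) {K : Set X} (hK : K ∈ F)
    {x : X} (hx : x ∈ K) : evalChar hF x ∈ dominated (supOn hF hK) :=
  fun f => norm_eval_le_supOn hF hK hx f

theorem FunAlg.exists_mem_forall_eval_eq_zero_imp (hF : IsDistinguishedFamily F) {s : Seminorm ℂ (FunAlg X F)}
    (hs : s ∈ contCStarSeminorms (FunAlg X F)) :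
    ∃ K ∈ F, ∀ f, (∀ x ∈ K, eval F x f = 0) → s f = 0 := by
  have h : s.ball 0 1 ∈ 𝓝 (0 : FunAlg X F) := Seminorm.ball_mem_nhds hs.2 one_pos
  obtain ⟨⟨K, ε⟩, ⟨hK, hε⟩, hKs⟩ := (hasBasis_nhds_zero hF).mem_iff.1 h
  refine ⟨K, hK, fun f hf => ?_⟩
  by_contra hne
  -- The rescaled function still vanishes on `K`, so it lies in the open unit ball although its
  -- seminorm is exactly `1`.
  have hmem : ((s f)⁻¹ : ℂ) • f ∈ s.ball 0 1 := hKs fun x hx => by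
    rw [map_smul, hf x hx, smul_zero, norm_zero]
    exact hε
  rw [Seminorm.mem_ball_zero, map_smul_eq_mul, norm_inv, Complex.norm_real,
    Real.norm_of_nonneg (apply_nonneg s f), inv_mul_cancel₀ hne] at hmem
  exact lt_irrefl _ hmem

/-- A character that is not an evaluation on the compact `K` takes the value `1` at some `f`
vanishing on `K`. But then `s f = 0`, against domination. -/
theorem FunAlg.exists_dominated_subset_image (hF : IsDistinguishedFamily F)
    {s : Seminorm ℂ (FunAlg X F)} (hs : s ∈ contCStarSeminorms (FunAlg X F)) :
    ∃ K ∈ F, dominated s ⊆ evalChar hF '' K := by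
  have := hF.commLocallyCStarAlgebra
  obtain ⟨K, hK, h⟩ := exists_mem_forall_eval_eq_zero_imp hF hs
  refine ⟨K, hK, fun χ hχ => ?_⟩
  by_contra hn
  obtain ⟨f, hf, hf1⟩ := exists_apply_eq_one_of_isCompact
    ((hF.isCompact K hK).image (continuous_evalChar hF)) hn
  have h0 : s f = 0 := h f fun x hx => hf _ ⟨x, hx, rfl⟩
  exact one_ne_zero (hf1.symm.trans (norm_le_zero_iff.1 ((hχ f).trans_eq h0)))

/-- The point `x` as a primitive ideal of `C(X)`. -/
def FunAlg.evalPrim (hF : IsDistinguishedFamily F) (x : X) : Prim (FunAlg X F) :=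
  (evalChar hF x).toPrim

@[simp]
theorem FunAlg.toContChar_evalPrim (hF : IsDistinguishedFamily F) (x : X) :
    (evalPrim hF x).toContChar = evalChar hF x := ContChar.toContChar_toPrim _

theorem FunAlg.evalPrim_mem_hullKer (hF : IsDistinguishedFamily F) {K : Set X} (hK : K ∈ F)
    {x : X} (hx : x ∈ K) : evalPrim hF x ∈ hullKer (supOn hF hK) := by
  have := hF.commLocallyCStarAlgebra
  rw [mem_hullKer_iff (supOn_mem hF hK), toContChar_evalPrim]
  exact evalChar_mem_dominated hF hK hx

theorem FunAlg.exists_hullKer_subset_image (hF : IsDistinguishedFamily F)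
    {s : Seminorm ℂ (FunAlg X F)} (hs : s ∈ contCStarSeminorms (FunAlg X F)) :
    ∃ K ∈ F, hullKer s ⊆ evalPrim hF '' K := by
  have := hF.commLocallyCStarAlgebra
  obtain ⟨K, hK, h⟩ := exists_dominated_subset_image hF hs
  refine ⟨K, hK, fun P hP => ?_⟩
  obtain ⟨x, hx, hxP⟩ := h ((mem_hullKer_iff hs P).1 hP)
  exact ⟨x, hx, Prim.toContChar_injective (by rw [toContChar_evalPrim, hxP])⟩

theorem IsDistinguishedFamily.continuous_of_forall {Y : Type*} [TopologicalSpace Y]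
    (hF : IsDistinguishedFamily F) {f : X → Y}
    (hf : ∀ K ∈ F, Continuous fun x : K => f x) : Continuous f :=
  continuous_iff_isClosed.2 fun _ hC => (hF.isClosed_iff _).2 fun K hK => hC.preimage (hf K hK)

theorem FunAlg.continuous_evalPrim (hF : IsDistinguishedFamily F) : Continuous (evalPrim hF) := by
  have := hF.commLocallyCStarAlgebra
  refine hF.continuous_of_forall fun K hK => ?_
  refine continuous_of_forall_mem_hullKer (supOn_mem hF hK)
    (fun x => evalPrim_mem_hullKer hF hK x.2) fun f => ?_
  simp only [toContChar_evalPrim]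
  exact (continuous_eval_apply f).comp continuous_subtype_val

theorem FunAlg.evalPrim_bijective (hF : IsDistinguishedFamily F)
    (hX : IsFunctionallyHausdorff X) : Function.Bijective (evalPrim hF) := by
  have := hF.commLocallyCStarAlgebra
  constructor
  · intro x y hxy
    by_contra hne
    obtain ⟨f, hf⟩ := hX x y hne
    have h : evalChar hF x = evalChar hF y := by
      rw [← toContChar_evalPrim, ← toContChar_evalPrim, hxy]
    let g : C(X, ℂ) := ⟨fun x => (f x : ℂ), Complex.continuous_ofReal.comp f.continuous⟩
    exact hf (Complex.ofReal_injective (DFunLike.congr_fun (congrArg Subtype.val h) g))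
  · intro P
    obtain ⟨K, -, h⟩ := exists_hullKer_subset_image hF P.toContChar.seminorm_mem
    obtain ⟨x, -, hx⟩ := h (mem_hullKer_seminorm P)
    exact ⟨x, hx⟩

theorem FunAlg.image_evalPrim_mem (hF : IsDistinguishedFamily F) {K : Set X} (hK : K ∈ F) :
    evalPrim hF '' K ∈ primFamily (FunAlg X F) := by
  have := hF.commLocallyCStarAlgebra
  refine mem_primFamily_iff.2 ⟨(hF.isCompact K hK).image (continuous_evalPrim hF), _,
    supOn_mem hF hK, ?_⟩
  rintro _ ⟨x, hx, rfl⟩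
  exact evalPrim_mem_hullKer hF hK hx

/-- This makes the inverse of `evalPrim` a morphism and yields the compact sets needed to see that
`evalPrim` is closed. -/
theorem FunAlg.preimage_evalPrim_mem (hF : IsDistinguishedFamily F)
    (hX : IsFunctionallyHausdorff X) {L : Set (Prim (FunAlg X F))}
    (hL : L ∈ primFamily (FunAlg X F)) : evalPrim hF ⁻¹' L ∈ F := by
  have := hF.commLocallyCStarAlgebra
  obtain ⟨hLc, s, hs, hLs⟩ := mem_primFamily_iff.1 hL
  obtain ⟨K, hK, h⟩ := exists_hullKer_subset_image hF hs
  have hsub : evalPrim hF ⁻¹' L ⊆ K := fun x hx =>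
    ((evalPrim_bijective hF hX).1.mem_set_image).1 (h (hLs hx))
  exact hF.mem_of_subset K hK _ hsub ((hF.isCompact K hK).of_isClosed_subset
    (hLc.isClosed.preimage (continuous_evalPrim hF)) hsub)

theorem FunAlg.isHomeomorph_evalPrim (hF : IsDistinguishedFamily F)
    (hX : IsFunctionallyHausdorff X) : IsHomeomorph (evalPrim hF) := by
  have := hF.commLocallyCStarAlgebra
  have hbij := evalPrim_bijective hF hX
  refine isHomeomorph_iff_continuous_isClosedMap_bijective.2
    ⟨continuous_evalPrim hF, fun C hC => ?_, hbij⟩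
  refine (isDistinguishedFamily_primFamily.isClosed_iff _).2 fun L hL => ?_
  have hK := hF.isCompact _ (preimage_evalPrim_mem hF hX hL)
  -- Closedness is tested on members `L` of the family, where the image of `C` is the image of a
  -- compact set.
  have hc := ((hK.inter_right hC).image (continuous_evalPrim hF)).isClosed
  have h : (Subtype.val : L → _) ⁻¹' (evalPrim hF '' C) =
      Subtype.val ⁻¹' (evalPrim hF '' (evalPrim hF ⁻¹' L ∩ C)) := by
    ext P
    constructor
    · rintro ⟨x, hx, hxP⟩
      exact ⟨x, ⟨by rw [Set.mem_preimage, hxP]; exact P.2, hx⟩, hxP⟩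
    · rintro ⟨x, hx, hxP⟩
      exact ⟨x, hx.2, hxP⟩
  rw [h]
  exact hc.preimage continuous_subtype_val

end FunAlg

/-! ### The Gelfand transform -/

section Gelfand

variable (A : Type u) [CommRing A] [StarRing A] [Algebra ℂ A] [UniformSpace A]
  [CommLocallyCStarAlgebra A]

/-- The Gelfand transform. -/
def gelfand : A →⋆ₐ[ℂ] FunAlg (Prim A) (primFamily A) where
  toFun a := (⟨fun P => P.toContChar.1 a, continuous_toContChar_apply a⟩ : C(Prim A, ℂ))
  map_one' := FunAlg.ext fun P => map_one P.toContChar.1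
  map_mul' a b := FunAlg.ext fun P => map_mul P.toContChar.1 a b
  map_zero' := FunAlg.ext fun P => map_zero P.toContChar.1
  map_add' a b := FunAlg.ext fun P => map_add P.toContChar.1 a b
  commutes' r := FunAlg.ext fun P => AlgHomClass.commutes P.toContChar.1 r
  map_star' a := FunAlg.ext fun P => map_star P.toContChar.1 a

variable {A}

theorem eval_gelfand (P : Prim A) (a : A) :
    FunAlg.eval (primFamily A) P (gelfand A a) = P.toContChar.1 a := rfl

theorem seminorm_le_of_forall_hullKer {s : Seminorm ℂ A} (hs : s ∈ contCStarSeminorms A) {a : A}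
    {r : ℝ} (hr : 0 ≤ r) (h : ∀ P ∈ hullKer s, ‖P.toContChar.1 a‖ ≤ r) : s a ≤ r :=
  seminorm_le_of_forall_dominated hs hr fun χ hχ => by
    simpa using h χ.toPrim ((mem_hullKer_iff hs _).2 (by simpa using hχ))

/-- An element killed by all characters has all continuous C⋆-seminorms zero, so the Hausdorff
property gives injectivity; surjectivity is `exists_forall_apply_eq`. -/
theorem gelfand_bijective : Function.Bijective (gelfand A) := by
  have := CommLocallyCStarAlgebra.isUniformAddGroup (A := A)
  have := CommLocallyCStarAlgebra.t2Space (A := A)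
  constructor
  · refine (injective_iff_map_eq_zero _).2 fun a ha => ?_
    by_contra hne
    obtain ⟨s, hs, ε, hε, h⟩ := exists_contCStarSeminorm_ball_subset
      (isOpen_compl_singleton.mem_nhds (Ne.symm hne) : {a}ᶜ ∈ 𝓝 (0 : A))
    refine h a ((seminorm_le_of_forall_hullKer hs le_rfl fun P _ => ?_).trans_lt hε) rfl
    rw [← eval_gelfand, ha, map_zero, norm_zero]
  · intro f
    obtain ⟨a, ha⟩ := exists_forall_apply_eq
      (fun χ : ContChar A => FunAlg.eval (primFamily A) χ.toPrim f) fun s hs =>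
        (FunAlg.continuous_eval_apply f).comp_continuousOn (continuousOn_toPrim hs)
    refine ⟨a, FunAlg.ext fun P => ?_⟩
    rw [eval_gelfand, ha, Prim.toPrim_toContChar]

variable (A) in
/-- The Gelfand transform as an isomorphism. -/
def gelfandEquiv : A ≃⋆ₐ[ℂ] FunAlg (Prim A) (primFamily A) :=
  StarAlgEquiv.ofBijective (gelfand A) gelfand_bijective

theorem continuous_gelfand : Continuous (gelfand A) := by
  have := CommLocallyCStarAlgebra.isUniformAddGroup (A := A)
  refine continuous_of_continuousAt_zero (gelfand A) ?_
  rw [ContinuousAt, map_zero,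
    (FunAlg.hasBasis_nhds_zero isDistinguishedFamily_primFamily).tendsto_right_iff]
  rintro ⟨_, ε⟩ ⟨⟨s, hs, rfl⟩, hε⟩
  filter_upwards [s.ball_mem_nhds hs.2 hε] with a ha P hP
  rw [Seminorm.mem_ball_zero] at ha
  exact ((mem_hullKer_iff hs P).1 hP a).trans_lt ha

theorem continuous_gelfandEquiv_symm : Continuous (gelfandEquiv A).symm := by
  have := CommLocallyCStarAlgebra.isUniformAddGroup (A := A)
  refine continuous_of_continuousAt_zero (gelfandEquiv A).symm ?_
  rw [ContinuousAt, map_zero]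
  intro U hU
  obtain ⟨s, hs, ε, hε, h⟩ := exists_contCStarSeminorm_ball_subset hU
  refine Filter.mem_map.2
    ((FunAlg.hasBasis_nhds_zero isDistinguishedFamily_primFamily).mem_iff.2
      ⟨(hullKer s, ε / 2), ⟨⟨s, hs, rfl⟩, half_pos hε⟩, fun f hf => ?_⟩)
  refine h _ ((seminorm_le_of_forall_hullKer hs (half_pos hε).le fun P hP => ?_).trans_lt
    (half_lt_self hε))
  rw [← eval_gelfand]
  change ‖FunAlg.eval _ P (gelfandEquiv A ((gelfandEquiv A).symm f))‖ ≤ _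
  rw [StarAlgEquiv.apply_symm_apply]
  exact (hf P hP).le

theorem isHomeomorph_gelfandEquiv : IsHomeomorph (gelfandEquiv A) :=
  Homeomorph.isHomeomorph
    { (gelfandEquiv A).toEquiv with
      continuous_toFun := continuous_gelfand
      continuous_invFun := continuous_gelfandEquiv_symm }

end Gelfand

/-! ### The functors are well defined -/

theorem funWellDefined : FunWellDefined.{u} where
  isLocallyCStar X := X.isDistinguished.commLocallyCStarAlgebra
  continuous_comp {X Y} f := by
    refine continuous_of_continuousAt_zero _ ?_
    rw [ContinuousAt, map_zero, (FunAlg.hasBasis_nhds_zero X.isDistinguished).tendsto_right_iff]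
    rintro ⟨K, ε⟩ ⟨hK, hε⟩
    filter_upwards [(FunAlg.hasBasis_nhds_zero Y.isDistinguished).mem_of_mem
      (i := (f.toMap '' K, ε)) ⟨f.image_mem K hK, hε⟩] with g hg x hx
    exact hg _ ⟨x, hx, rfl⟩

/-! ### Functoriality of the primitive spectrum -/

section PrimComap

variable {A B : CommLocCStarAlg.{u}} (φ : A ⟶ B)

/-- Pull-back of characters. -/
def ContChar.comap (χ : ContChar B.carrier) : ContChar A.carrier :=
  ⟨χ.1.comp φ.toHom, χ.2.comp φ.continuous_toHom⟩

theorem isPrimitiveIdeal_comap (P : Prim B.carrier) : IsPrimitiveIdeal (P.1.comap φ.toHom) := by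
  convert (P.toContChar.comap φ).isPrimitiveIdeal
  ext a
  exact P.mem_iff _

theorem toContChar_primComap (P : Prim B.carrier) :
    (primComap φ (isPrimitiveIdeal_comap φ) P).toContChar = P.toContChar.comap φ :=
  ContChar.eq_of_forall_eq_zero fun a ha => (P.mem_iff (φ.toHom a)).1
    ((Prim.mem_iff (primComap φ (isPrimitiveIdeal_comap φ) P) a).2 ha)

/-- Pull-back of seminorms. -/
def pullbackSeminorm (s : Seminorm ℂ B.carrier) : Seminorm ℂ A.carrier :=
  s.comp φ.toHom.toAlgHom.toLinearMap

theorem pullbackSeminorm_apply (s : Seminorm ℂ B.carrier) (a : A.carrier) :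
    pullbackSeminorm φ s a = s (φ.toHom a) := rfl

theorem pullbackSeminorm_mem {s : Seminorm ℂ B.carrier} (hs : s ∈ contCStarSeminorms B.carrier) :
    pullbackSeminorm φ s ∈ contCStarSeminorms A.carrier where
  left :=
    { mul_le := fun a b => by
        simp only [pullbackSeminorm_apply, map_mul]
        exact hs.1.mul_le _ _
      star_eq := fun a => by simp only [pullbackSeminorm_apply, map_star, hs.1.star_eq]
      star_mul_self := fun a => by
        simp only [pullbackSeminorm_apply, map_mul, map_star, hs.1.star_mul_self] }
  right := hs.2.comp φ.continuous_toHom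

theorem primComap_mem_hullKer {s : Seminorm ℂ B.carrier} {P : Prim B.carrier}
    (hP : P ∈ hullKer s) :
    primComap φ (isPrimitiveIdeal_comap φ) P ∈ hullKer (pullbackSeminorm φ s) :=
  fun a ha => hP (φ.toHom a) ha

/-- Continuity is tested on each `hullKer s`, which is sent into `hullKer` of the pulled-back
seminorm; there Gelfand continuity suffices. -/
theorem continuous_primComap : Continuous (primComap φ (isPrimitiveIdeal_comap φ)) := by
  refine isDistinguishedFamily_primFamily.continuous_of_forall ?_
  rintro _ ⟨s, hs, rfl⟩
  refine continuous_of_forall_mem_hullKer (pullbackSeminorm_mem φ hs)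
    (fun P => primComap_mem_hullKer φ P.2) fun a => ?_
  simp only [toContChar_primComap]
  exact (continuous_toContChar_apply (φ.toHom a)).comp continuous_subtype_val

end PrimComap

theorem primWellDefined : PrimWellDefined.{u} where
  isDistinguished _ := isDistinguishedFamily_primFamily
  isFunctionallyHausdorff _ := isFunctionallyHausdorff_prim
  isPrimitiveIdeal_comap := isPrimitiveIdeal_comap
  continuous_comap := continuous_primComap
  image_mem φ K hK := by
    obtain ⟨hKc, s, hs, hKs⟩ := mem_primFamily_iff.1 hK
    refine mem_primFamily_iff.2 ⟨hKc.image (continuous_primComap φ), _,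
      pullbackSeminorm_mem φ hs, ?_⟩
    rintro _ ⟨P, hP, rfl⟩
    exact primComap_mem_hullKer φ (hKs hP)

/-! ### The duality -/

/-- The Gelfand transform as an isomorphism of the category. -/
def gelfandIso (A : CommLocCStarAlg.{u}) :
    A ≅ (funFunctor funWellDefined).obj (Opposite.op
      ((primFunctor primWellDefined).obj (Opposite.op A))) where
  hom := ⟨gelfand A.carrier, continuous_gelfand⟩
  inv := ⟨StarAlgHomClass.toStarAlgHom (gelfandEquiv A.carrier).symm, continuous_gelfandEquiv_symm⟩
  hom_inv_id := CommLocCStarAlg.Hom.ext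
    (StarAlgHom.ext fun a => (gelfandEquiv A.carrier).symm_apply_apply a)
  inv_hom_id := CommLocCStarAlg.Hom.ext
    (StarAlgHom.ext fun f => (gelfandEquiv A.carrier).apply_symm_apply f)

/-- A space is isomorphic to the primitive spectrum of its function algebra. -/
def evalPrimIso (X : DistSpace.{u}) :
    X ≅ (primFunctor primWellDefined).obj (Opposite.op
      ((funFunctor funWellDefined).obj (Opposite.op X))) :=
  let h := (FunAlg.isHomeomorph_evalPrim X.isDistinguished X.isFunctionallyHausdorff).homeomorph
  { hom := ⟨⟨FunAlg.evalPrim X.isDistinguished, FunAlg.continuous_evalPrim _⟩,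
      fun _ hK => FunAlg.image_evalPrim_mem X.isDistinguished hK⟩
    inv := ⟨⟨h.symm, h.symm.continuous⟩, fun L hL => by
      have := FunAlg.preimage_evalPrim_mem X.isDistinguished X.isFunctionallyHausdorff hL
      change h.symm '' L ∈ X.family
      rwa [h.image_symm]⟩
    hom_inv_id := DistSpace.Hom.ext (ContinuousMap.ext h.symm_apply_apply)
    inv_hom_id := DistSpace.Hom.ext (ContinuousMap.ext h.apply_symm_apply) }

theorem comp_primComap_gelfand {A B : CommLocCStarAlg.{u}} (φ : A ⟶ B) (a : A.carrier) :
    (FunAlg.comp ⟨_, continuous_primComap φ⟩ (gelfand A.carrier a) :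
      FunAlg (Prim B.carrier) (primFamily B.carrier)) = gelfand B.carrier (φ.toHom a) :=
  FunAlg.ext fun P => DFunLike.congr_fun (congrArg Subtype.val (toContChar_primComap φ P)) a

theorem primComap_evalPrim {X Y : DistSpace.{u}} (f : X ⟶ Y) (x : X.carrier) :
    primComap ((funFunctor funWellDefined).map f.op) (isPrimitiveIdeal_comap _)
      (FunAlg.evalPrim X.isDistinguished x) = FunAlg.evalPrim Y.isDistinguished (f.toMap x) :=
  Subtype.ext rfl

/-- The duality between commutative locally C⋆-algebras and spaces with a distinguished family of
compact sets. -/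
def primEquivalence : CommLocCStarAlg.{u}ᵒᵖ ≌ DistSpace.{u} :=
  CategoryTheory.Equivalence.mk (primFunctor primWellDefined) (funFunctor funWellDefined).rightOp
    -- `Equivalence.mk` corrects the unit, so the triangle identities need no check, and it keeps
    -- both functors as given. Taking opposites reverses the Gelfand isomorphism, hence `symm`.
    (NatIso.ofComponents (fun A => (gelfandIso A.unop).op) (fun {_ _} φ =>
      Quiver.Hom.unop_inj (CommLocCStarAlg.Hom.ext
        (StarAlgHom.ext (comp_primComap_gelfand φ.unop))))).symm
    (NatIso.ofComponents evalPrimIso (fun {_ _} f =>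
      DistSpace.Hom.ext (ContinuousMap.ext fun x => (primComap_evalPrim f x).symm))).symm

end LocCStar

end

theorem mainTheorem2 :
    (∀ (A : Type u) [CommRing A] [StarRing A] [Algebra ℂ A] [UniformSpace A]
        [LocCStar.CommLocallyCStarAlgebra A],
      LocCStar.IsCompactlyGeneratedSpace (LocCStar.Prim A) ∧
      LocCStar.IsFunctionallyHausdorff (LocCStar.Prim A) ∧
      LocCStar.IsDistinguishedFamily (LocCStar.primFamily A) ∧
      ∃ Φ : A ≃⋆ₐ[ℂ] LocCStar.FunAlg (LocCStar.Prim A) (LocCStar.primFamily A),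
        IsHomeomorph Φ) ∧
    ∃ (hC : LocCStar.FunWellDefined.{u}) (hP : LocCStar.PrimWellDefined.{u})
      (e : LocCStar.CommLocCStarAlg.{u}ᵒᵖ ≌ LocCStar.DistSpace.{u}),
      e.functor = LocCStar.primFunctor hP ∧
      e.inverse = (LocCStar.funFunctor hC).rightOp :=
  ⟨fun A _ _ _ _ _ => ⟨⟨_, LocCStar.isDistinguishedFamily_primFamily⟩,
    LocCStar.isFunctionallyHausdorff_prim, LocCStar.isDistinguishedFamily_primFamily,
    LocCStar.gelfandEquiv A, LocCStar.isHomeomorph_gelfandEquiv⟩,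
    LocCStar.funWellDefined, LocCStar.primWellDefined, LocCStar.primEquivalence, rfl, rfl⟩
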